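/- Let $d\ge 1$, $N\ge 1$, $\zeta=d/N$, $\sigma_0>0$, $\boldsymbol\theta_0\in\mathbb R^d$, and let $\boldsymbol\Sigma$ be a positive definite $d\times d$ matrix with eigenvalues $\lambda_1(\boldsymbol\Sigma),\dots,\lambda_d(\boldsymbol\Sigma)$. The data $\mathscr D=(\mathbf z_1,\dots,\mathbf z_N,\mathbf t)$ consist of i.i.d. covariates $\mathbf z_i\sim\mathcal N(\mathbf 0,\boldsymbol\Sigma)$ and responses $\mathbf t=\mathbf Z\boldsymbol\theta_0+\boldsymbol\epsilon$, where $\mathbf Z$ is the $N\times d$ matrix with entries $z_i(\mu)/\sqrt d$ and $\boldsymbol\epsilon\sim\mathcal N(\mathbf 0,\sigma_0^2\mathbf I_N)$ is independent of $\mathbf Z$. Let $\hat{\boldsymbol\theta}_{\rm ML}=(\mathbf Z^{\rm T}\mathbf Z)^{-1}\mathbf Z^{\rm T}\mathbf t$, let $\|\cdot\|$ be the Euclidean norm, and for $\nu,\omega>0$ let $\Gamma_\nu(\omega)=\frac{\nu^{\nu/2}}{2^{\nu/2}\Gamma(\nu/2)}\,\omega^{(\nu-2)/2}e^{-\nu\omega/2}$.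 (i) If $d\le N$, then for every $\alpha\in\mathbb R$ $$\Big\langle e^{i\alpha\|\boldsymbol\theta_0-\hat{\boldsymbol\theta}_{\rm ML}\|^2}\Big\rangle_{\mathscr D}=\int_0^\infty \Gamma_{N+1-d}(\omega)\prod_{\ell=1}^d\Big(1-\frac{2i\alpha\zeta\sigma_0^2}{\omega(1-\zeta+1/N)\lambda_\ell(\boldsymbol\Sigma)}\Big)^{-1/2}d\omega,$$ with the principal branch of the power and an absolutely convergent integral. (ii) If $N>d+1$, then $\frac1d\|\boldsymbol\theta_0-\hat{\boldsymbol\theta}_{\rm ML}\|^2$ is integrable, with mean $\dfrac{\zeta\sigma_0^2}{1-\zeta-1/N}\,\dfrac{\mathrm{Tr}[\boldsymbol\Sigma^{-1}]}{d}$. (iii) If $N>d+3$, then $\frac1d\|\boldsymbol\theta_0-\hat{\boldsymbol\theta}_{\rm ML}\|^2$ is square integrable, with variance $$V=\frac{\zeta^2\sigma_0^4}{(1-\zeta-1/N)(1-\zeta-3/N)}\Big[\Big(\frac{\mathrm{Tr}[\boldsymbol\Sigma^{-1}]}{d}\Big)^2+\frac{2}{d^2}\mathrm{Tr}[\boldsymbol\Sigma^{-2}]\Big]-\frac{\zeta^2\sigma_0^4}{(1-\zeta-1/N)^2}\Big(\frac{\mathrm{Tr}[\boldsymbol\Sigma^{-1}]}{d}\Big)^2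 .$$ (iv) Put $V_\infty=\dfrac{2\zeta^2\sigma_0^4}{(1-\zeta)^2}\dfrac{\mathrm{Tr}[\boldsymbol\Sigma^{-2}]}{d^2}$. Along any sequence $(N,d,\boldsymbol\Sigma,\boldsymbol\theta_0)$ with $\sigma_0$ fixed, $N\to\infty$, and $\zeta=d/N$ converging to a limit smaller than $1$, $$V=V_\infty+O\Big(\frac{1}{N}\Big(\zeta\,\frac{\mathrm{Tr}[\boldsymbol\Sigma^{-1}]}{d}\Big)^2\Big).$$ In particular $V-V_\infty\to0$ whenever $\mathrm{Tr}[\boldsymbol\Sigma^{-1}]/d$ is bounded. Moreover $V/V_\infty\to1$ if and only if $\mathrm{Tr}[\boldsymbol\Sigma^{-1}]^2/(N\,\mathrm{Tr}[\boldsymbol\Sigma^{-2}])\to0$. -/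

import Mathlib

open MeasureTheory ProbabilityTheory Filter Asymptotics
open scoped Topology

namespace GaussianRegression

/-- A data set `𝒟`: covariate vectors `z₁, …, z_N ∈ ℝᵈ` and responses `t ∈ ℝᴺ`. -/
abbrev Dataset (N d : ℕ) : Type :=
  (Fin N → EuclideanSpace ℝ (Fin d)) × (Fin N → ℝ)

/-- The `N × d` design matrix `Z`, with rescaled covariates `zᵢ(μ) / √d`. -/
noncomputable def designMatrix {N d : ℕ} (z : Fin N → EuclideanSpace ℝ (Fin d)) :
    Matrix (Fin N) (Fin d) ℝ :=
  Matrix.of fun i μ => z i μ / Real.sqrt d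

/-- The law of `𝒟 = (z, t)`: `z₁, …, z_N` are i.i.d. `𝒩(0, Σ)`, and `t = Z θ₀ + ε` with noise
`ε ∼ 𝒩(0, σ₀² I_N)` independent of the covariates. -/
noncomputable def dataLaw (N : ℕ) {d : ℕ} (S : Matrix (Fin d) (Fin d) ℝ)
    (θ₀ : EuclideanSpace ℝ (Fin d)) (σ₀ : ℝ) : Measure (Dataset N d) :=
  ((Measure.pi fun _ : Fin N => multivariateGaussian (0 : EuclideanSpace ℝ (Fin d)) S).prod
    (Measure.pi fun _ : Fin N => gaussianReal 0 (Real.toNNReal (σ₀ ^ 2)))).map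
    fun p => (p.1, (designMatrix p.1).mulVec θ₀ + p.2)

/-- The maximum likelihood estimator `(Zᵀ Z)⁻¹ Zᵀ t`. -/
noncomputable def mlEstimator {N d : ℕ} (D : Dataset N d) : EuclideanSpace ℝ (Fin d) :=
  WithLp.toLp 2 (((designMatrix D.1).transpose * designMatrix D.1)⁻¹.mulVec
    ((designMatrix D.1).transpose.mulVec D.2))

/-- The square error `(1/d) ‖θ₀ - θ̂_ML[𝒟]‖²`. -/
noncomputable def mse {N d : ℕ} (θ₀ : EuclideanSpace ℝ (Fin d)) (D : Dataset N d) : ℝ :=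
  ‖θ₀ - mlEstimator D‖ ^ 2 / d

/-- The ratio `ζ = d / N`. -/
noncomputable def ratio (N d : ℕ) : ℝ := (d : ℝ) / N

/-- The gamma density `Γ_ν(ω) = ν^(ν/2) / (2^(ν/2) Γ(ν/2)) · ω^((ν-2)/2) · e^(-νω/2)`
on `ω > 0`. -/
noncomputable def gammaDensity (ν ω : ℝ) : ℝ :=
  ν ^ (ν / 2) / (2 ^ (ν / 2) * Real.Gamma (ν / 2)) * ω ^ ((ν - 2) / 2) * Real.exp (-(ν * ω) / 2)

/-- The variance of the square error over the data sets. -/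
noncomputable def mseVariance (N : ℕ) {d : ℕ} (S : Matrix (Fin d) (Fin d) ℝ)
    (θ₀ : EuclideanSpace ℝ (Fin d)) (σ₀ : ℝ) : ℝ :=
  variance (mse θ₀) (dataLaw N S θ₀ σ₀)

/-- The expression `2 ζ² σ₀⁴ / (1 - ζ)² · Tr[Σ⁻²] / d²`. -/
noncomputable def asympVariance (N : ℕ) {d : ℕ} (S : Matrix (Fin d) (Fin d) ℝ) (σ₀ : ℝ) : ℝ :=
  2 * ratio N d ^ 2 * σ₀ ^ 4 / (1 - ratio N d) ^ 2 * ((S⁻¹ ^ 2).trace / (d : ℝ) ^ 2)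

end GaussianRegression

namespace GaussianRegression

/-! ### Gamma laws: moments, characteristic function, scaling -/

section Gamma

variable {a r : ℝ} {E : Type*} [NormedAddCommGroup E] [NormedSpace ℝ E]

/-! Almost surely `ZᵀZ` is invertible and the error is `-(ZᵀZ)⁻¹Zᵀε`. Given the covariates it is a
centred Gaussian vector with covariance `σ₀²(ZᵀZ)⁻¹`, so its characteristic function at `t` is the
mean of `exp(-σ₀² tᵀ(ZᵀZ)⁻¹t / 2)`. No Wishart density is needed to compute this mean, because for a
fixed `t` only one scalar matters. Factor `Σ = BBᵀ` with `B` chosen so that `t = c B e₀`. Then `Z =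
GBᵀ/√d` with `G` standard Gaussian, and `tᵀ(ZᵀZ)⁻¹t = d c² (GᵀG)⁻¹₀₀`, where `c² = tᵀΣ⁻¹t`. The
entry `(GᵀG)⁻¹₀₀` is the inverse squared distance from the first column of `G` to the span of the
others, that is, the inverse of a chi-square variable with `N + 1 - d` degrees of freedom
(`gaussianMatrix_map_inv_gram_zero_zero`, `charFun_error`).

The resulting characteristic function is that of a Gaussian scale mixture. In the eigenbasis of `Σ`
the error has independent normal coordinates, all divided by the square root of one normalised
chi-square variable `ω` (`map_error_eq`). Hence its squared norm has the law of `ω⁻¹ ∑ aₗ hₗ²`, with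
`hₗ` standard normal and independent of `ω`.

Integrating out `h` gives the product formula (i). Parts (ii) and (iii) multiply the inverse moments
of `ω` by the first two moments of `∑ aₗ hₗ²`. For (iv), `V - V_∞` is exactly `1/N` times a
combination of `Tr[Σ⁻¹]²` and `Tr[Σ⁻²]` whose coefficients are controlled in the limit. After
division by `V_∞` only the first trace survives, with a nonzero limiting coefficient, which gives
the equivalence. -/

lemma gammaMeasure_eq_restrict (a r : ℝ) :
    gammaMeasure a r = (volume.restrict (Set.Ioi 0)).withDensity (gammaPDF a r) := by
  rw [← restrict_withDensity measurableSet_Ioi, gammaMeasure, Measure.restrict_eq_self_of_ae_mem]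
  have hm : Measurable (gammaPDF a r) := (measurable_gammaPDFReal a r).ennreal_ofReal
  rw [ae_withDensity_iff hm]
  -- The density is only known to vanish for negative arguments, so the point 0 is discarded as a
  -- null set.
  filter_upwards [Measure.ae_ne volume (0 : ℝ)] with x hx h
  by_contra hx'
  exact h (gammaPDF_of_neg (lt_of_le_of_ne (not_lt.1 hx') hx))

lemma ae_pos_gammaMeasure (a r : ℝ) : ∀ᵐ x ∂(gammaMeasure a r), 0 < x := by
  rw [gammaMeasure_eq_restrict]
  exact (withDensity_absolutelyContinuous _ _).ae_le (ae_restrict_mem measurableSet_Ioi)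

lemma gammaPDF_toReal_of_pos (ha : 0 < a) (hr : 0 < r) {x : ℝ} (hx : 0 < x) :
    (gammaPDF a r x).toReal = r ^ a / Real.Gamma a * x ^ (a - 1) * Real.exp (-(r * x)) := by
  have := Real.Gamma_pos_of_pos ha
  rw [gammaPDF_of_nonneg hx.le, ENNReal.toReal_ofReal (by positivity)]

lemma integral_gammaMeasure (ha : 0 < a) (hr : 0 < r) (f : ℝ → E) :
    ∫ x, f x ∂(gammaMeasure a r) = ∫ x in Set.Ioi 0,
      (r ^ a / Real.Gamma a * x ^ (a - 1) * Real.exp (-(r * x))) • f x := by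
  have hm : Measurable (gammaPDF a r) := (measurable_gammaPDFReal a r).ennreal_ofReal
  rw [gammaMeasure_eq_restrict, integral_withDensity_eq_integral_toReal_smul hm
    (ae_of_all _ fun x => ENNReal.ofReal_lt_top)]
  refine setIntegral_congr_fun measurableSet_Ioi fun x hx => ?_
  simp only [gammaPDF_toReal_of_pos ha hr hx]

lemma integrable_gammaMeasure_iff (ha : 0 < a) (hr : 0 < r) (f : ℝ → E) :
    Integrable f (gammaMeasure a r) ↔ IntegrableOn (fun x =>
      (r ^ a / Real.Gamma a * x ^ (a - 1) * Real.exp (-(r * x))) • f x) (Set.Ioi 0) := by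
  have hm : Measurable (gammaPDF a r) := (measurable_gammaPDFReal a r).ennreal_ofReal
  rw [gammaMeasure_eq_restrict, integrable_withDensity_iff_integrable_smul' hm
    (ae_of_all _ fun x => ENNReal.ofReal_lt_top)]
  refine integrableOn_congr_fun (fun x hx => ?_) measurableSet_Ioi
  simp only [gammaPDF_toReal_of_pos ha hr hx]

lemma gamma_density_mul_rpow_mul_exp {s t x : ℝ} (hx : 0 < x) :
    (r ^ a / Real.Gamma a * x ^ (a - 1) * Real.exp (-(r * x))) • (x ^ s * Real.exp (t * x)) =
      r ^ a / Real.Gamma a * (x ^ (a + s - 1) * Real.exp (-((r - t) * x))) := by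
  rw [show a + s - 1 = (a - 1) + s by ring, Real.rpow_add hx,
    show -((r - t) * x) = -(r * x) + t * x by ring, Real.exp_add, smul_eq_mul]
  ring

lemma integrable_rpow_mul_exp_gammaMeasure {s t : ℝ} (ha : 0 < a) (hr : 0 < r) (hs : 0 < a + s)
    (ht : t < r) : Integrable (fun x => x ^ s * Real.exp (t * x)) (gammaMeasure a r) := by
  rw [integrable_gammaMeasure_iff ha hr, integrableOn_congr_fun
    (fun x (hx : x ∈ Set.Ioi 0) => gamma_density_mul_rpow_mul_exp hx) measurableSet_Ioi]
  refine Integrable.const_mul ?_ _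
  have h := integrableOn_rpow_mul_exp_neg_mul_rpow (p := 1) (s := a + s - 1) (b := r - t)
    (by linarith) one_pos (by linarith)
  simp only [Real.rpow_one, neg_mul] at h
  exact h

lemma integral_rpow_mul_exp_gammaMeasure {s t : ℝ} (ha : 0 < a) (hr : 0 < r) (hs : 0 < a + s)
    (ht : t < r) : ∫ x, x ^ s * Real.exp (t * x) ∂(gammaMeasure a r) =
      r ^ a / Real.Gamma a * ((1 / (r - t)) ^ (a + s) * Real.Gamma (a + s)) := by
  rw [integral_gammaMeasure ha hr, setIntegral_congr_fun measurableSet_Ioi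
    (fun x hx => gamma_density_mul_rpow_mul_exp hx), integral_const_mul,
    Real.integral_rpow_mul_exp_neg_mul_Ioi hs (by linarith)]

/-- Near 0 the integrand behaves like `x ^ (a - 2)`, hence the threshold `a > 1`. With `a = (N + 1 -
d) / 2` it reads `N > d + 1`; the threshold `a > 2` of the second inverse moment reads `N > d + 3`.
-/
lemma integrable_inv_gammaMeasure (ha : 1 < a) (hr : 0 < r) :
    Integrable (fun x => x⁻¹) (gammaMeasure a r) := by
  have h := integrable_rpow_mul_exp_gammaMeasure (a := a) (r := r) (s := -1) (t := 0)
    (by linarith) hr (by linarith) hr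
  simpa [Real.rpow_neg_one] using h

lemma integral_inv_gammaMeasure (ha : 1 < a) (hr : 0 < r) :
    ∫ x, x⁻¹ ∂(gammaMeasure a r) = r / (a - 1) := by
  have h := integral_rpow_mul_exp_gammaMeasure (a := a) (r := r) (s := -1) (t := 0)
    (by linarith) hr (by linarith) hr
  have hg : Real.Gamma a = (a - 1) * Real.Gamma (a - 1) := by
    rw [← Real.Gamma_add_one (by linarith)]; ring_nf
  have hp : 0 < Real.Gamma (a - 1) := Real.Gamma_pos_of_pos (by linarith)
  have h1 : a - 1 ≠ 0 := by linarith
  simp only [Real.rpow_neg_one, zero_mul, Real.exp_zero, mul_one, sub_zero, one_div] at h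
  rw [h, hg, ← sub_eq_add_neg, Real.inv_rpow hr.le, Real.rpow_sub_one hr.ne']
  have : r ^ a ≠ 0 := by positivity
  field_simp

lemma rpow_neg_two_eq {x : ℝ} : x ^ (-2 : ℝ) = (x⁻¹) ^ 2 := by
  rw [show (-2 : ℝ) = ((-2 : ℤ) : ℝ) by norm_num, Real.rpow_intCast, zpow_neg, inv_pow]
  norm_cast

lemma integrable_inv_sq_gammaMeasure (ha : 2 < a) (hr : 0 < r) :
    Integrable (fun x => x⁻¹ ^ 2) (gammaMeasure a r) := by
  have h := integrable_rpow_mul_exp_gammaMeasure (a := a) (r := r) (s := -2) (t := 0)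
    (by linarith) hr (by linarith) hr
  simpa only [rpow_neg_two_eq, zero_mul, Real.exp_zero, mul_one] using h

lemma integral_inv_sq_gammaMeasure (ha : 2 < a) (hr : 0 < r) :
    ∫ x, x⁻¹ ^ 2 ∂(gammaMeasure a r) = r ^ 2 / ((a - 1) * (a - 2)) := by
  have h := integral_rpow_mul_exp_gammaMeasure (a := a) (r := r) (s := -2) (t := 0)
    (by linarith) hr (by linarith) hr
  have hg : Real.Gamma a = (a - 1) * ((a - 2) * Real.Gamma (a - 2)) := by
    rw [← Real.Gamma_add_one (by linarith), show a - 2 + 1 = a - 1 by ring,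
      ← Real.Gamma_add_one (by linarith)]; ring_nf
  have hp : 0 < Real.Gamma (a - 2) := Real.Gamma_pos_of_pos (by linarith)
  have h1 : a - 1 ≠ 0 := by linarith
  have h2 : a - 2 ≠ 0 := by linarith
  simp only [rpow_neg_two_eq, zero_mul, Real.exp_zero, mul_one, sub_zero, one_div] at h
  rw [h, hg, ← sub_eq_add_neg, Real.inv_rpow hr.le, Real.rpow_sub hr, Real.rpow_two]
  have : r ^ a ≠ 0 := by positivity
  field_simp

lemma Iio_subset_integrableExpSet_gammaMeasure (ha : 0 < a) (hr : 0 < r) :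
    Set.Iio r ⊆ integrableExpSet id (gammaMeasure a r) := by
  intro t ht
  have h := integrable_rpow_mul_exp_gammaMeasure (s := 0) ha hr (by linarith) ht
  simpa [integrableExpSet] using h

lemma mgf_gammaMeasure (ha : 0 < a) (hr : 0 < r) {t : ℝ} (ht : t < r) :
    mgf id (gammaMeasure a r) t = (1 - t / r) ^ (-a) := by
  have h := integral_rpow_mul_exp_gammaMeasure (s := 0) ha hr (by linarith) ht
  simp only [Real.rpow_zero, one_mul, add_zero] at h
  have hp : 0 < Real.Gamma a := Real.Gamma_pos_of_pos ha
  have h1 : 0 < r - t := by linarith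
  rw [mgf]
  simp only [id]
  rw [h, one_div, Real.inv_rpow h1.le, show 1 - t / r = (r - t) / r by field_simp,
    Real.rpow_neg (by positivity), Real.div_rpow h1.le hr.le]
  field_simp

/-- Analytic continuation from the real axis. On the half-plane `Re z < r` the base `1 - z/r` has
positive real part, so it avoids the branch cut and the principal power is analytic there. -/
lemma complexMGF_gammaMeasure (ha : 0 < a) (hr : 0 < r) {z : ℂ} (hz : z.re < r) :
    complexMGF id (gammaMeasure a r) z = (1 - z / r) ^ (-a : ℂ) := by
  set U : Set ℂ := {z | z.re < r}
  have hUo : IsOpen U := isOpen_lt Complex.continuous_re continuous_const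
  have hr0 : (r : ℂ) ≠ 0 := by exact_mod_cast hr.ne'
  have hre (z : ℂ) (hz : z ∈ U) : 0 < (1 - z / r).re := by
    rw [Complex.sub_re, Complex.one_re, Complex.div_ofReal_re, sub_pos, div_lt_one hr]
    exact hz
  have hX : AnalyticOnNhd ℂ (complexMGF id (gammaMeasure a r)) U :=
    analyticOnNhd_complexMGF.mono fun z hz =>
      interior_mono (Iio_subset_integrableExpSet_gammaMeasure ha hr) (by
        rw [interior_Iio]; exact hz)
  have hY : AnalyticOnNhd ℂ (fun z : ℂ => (1 - z / r) ^ (-a : ℂ)) U := by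
    refine DifferentiableOn.analyticOnNhd (fun z hz => ?_) hUo
    refine DifferentiableAt.differentiableWithinAt ?_
    refine DifferentiableAt.cpow (by fun_prop) (by fun_prop) ?_
    exact Or.inl (hre z hz)
  refine AnalyticOnNhd.eqOn_of_preconnected_of_frequently_eq (z₀ := 0) hX hY
    (convex_halfSpace_re_lt r).isPreconnected (by simpa [U] using hr) ?_ hz
  have h_real : ∀ᶠ (x : ℝ) in 𝓝[≠] 0,
      complexMGF id (gammaMeasure a r) x = (1 - (x : ℂ) / r) ^ (-a : ℂ) := by
    filter_upwards [nhdsWithin_le_nhds (Iio_mem_nhds hr)] with x hx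
    rw [complexMGF_ofReal, mgf_gammaMeasure ha hr hx, Complex.ofReal_cpow]
    · push_cast; rfl
    · rw [sub_nonneg, div_le_one hr]; exact le_of_lt hx
  have ht : Tendsto (fun x : ℝ => (x : ℂ)) (𝓝[≠] 0) (𝓝[≠] 0) := by
    refine tendsto_nhdsWithin_iff.2 ⟨?_, ?_⟩
    · exact (Complex.continuous_ofReal.tendsto' 0 0 (by simp)).mono_left nhdsWithin_le_nhds
    · filter_upwards [self_mem_nhdsWithin] with x hx
      simpa using hx
  exact ht.frequently h_real.frequently

lemma charFun_gammaMeasure (ha : 0 < a) (hr : 0 < r) (t : ℝ) :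
    charFun (gammaMeasure a r) t = (1 - t * Complex.I / r) ^ (-a : ℂ) := by
  rw [← complexMGF_id_mul_I, complexMGF_gammaMeasure ha hr (by simpa using hr)]

lemma gammaMeasure_map_mul (ha : 0 < a) (hr : 0 < r) {c : ℝ} (hc : 0 < c) :
    (gammaMeasure a r).map (c * ·) = gammaMeasure a (r / c) := by
  have := isProbabilityMeasure_gammaMeasure ha hr
  have := isProbabilityMeasure_gammaMeasure ha (div_pos hr hc)
  have : IsProbabilityMeasure ((gammaMeasure a r).map (c * ·)) :=
    Measure.isProbabilityMeasure_map (by fun_prop)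
  refine Measure.ext_of_charFun ?_
  ext t
  rw [charFun_map_mul, charFun_gammaMeasure ha hr, charFun_gammaMeasure ha (div_pos hr hc)]
  have hc' : (c : ℂ) ≠ 0 := by exact_mod_cast hc.ne'
  have hr' : (r : ℂ) ≠ 0 := by exact_mod_cast hr.ne'
  congr 2
  push_cast
  field_simp

end Gamma

/-! ### Chi-square laws from Gaussian vectors -/

section ChiSquare

/-- Principal powers are not multiplicative in general, but a positive real factor leaves the
argument unchanged. -/
lemma ofReal_mul_cpow {r : ℝ} (hr : 0 < r) {b : ℂ} (hb : b ≠ 0) (s : ℂ) :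
    ((r : ℂ) * b) ^ s = (r : ℂ) ^ s * b ^ s := by
  have hr0 : (r : ℂ) ≠ 0 := by exact_mod_cast hr.ne'
  rw [Complex.cpow_def_of_ne_zero (mul_ne_zero hr0 hb), Complex.cpow_def_of_ne_zero hr0,
    Complex.cpow_def_of_ne_zero hb, Complex.log_ofReal_mul hr hb, ← Complex.exp_add,
    Complex.ofReal_log hr.le, add_mul]

lemma integral_cexp_sq_gaussianReal (c : ℝ) :
    ∫ x : ℝ, Complex.exp (Complex.I * c * (x : ℂ) ^ 2) ∂(gaussianReal 0 1) =
      (1 - 2 * Complex.I * c) ^ (-(1 / 2) : ℂ) := by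
  rw [integral_gaussianReal_eq_integral_smul one_ne_zero]
  -- The phase merges with the Gaussian weight into `exp(-b x²)`. Since `Re b = 1/2 > 0`, the
  -- integral converges and every power stays on the principal branch.
  set b : ℂ := (1 - 2 * Complex.I * c) / 2 with hb
  have hbre : b.re = 1 / 2 := by simp [hb]
  have hb0 : 0 < b.re := by rw [hbre]; norm_num
  have hbne : b ≠ 0 := fun h => by simp [h] at hb0
  have hint : ∀ x : ℝ, gaussianPDFReal 0 1 x • Complex.exp (Complex.I * c * (x : ℂ) ^ 2) =
      ((√(2 * Real.pi))⁻¹ : ℝ) * Complex.exp (-b * (x : ℂ) ^ 2) := by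
    intro x
    rw [gaussianPDFReal, Complex.real_smul, Complex.ofReal_mul, Complex.ofReal_exp, mul_assoc,
      ← Complex.exp_add]
    congr 2
    · simp
    · push_cast; rw [hb]; ring
  simp_rw [hint]
  rw [integral_const_mul, integral_gaussian_complex hb0]
  have h2 : (1 - 2 * Complex.I * c : ℂ) = 2 * b := by rw [hb]; ring
  have hbarg : b.arg ≠ Real.pi := by
    intro h
    rw [Complex.arg_eq_pi_iff] at h
    linarith [h.1]
  have hpi : (Real.pi : ℂ) / b = ((Real.pi : ℝ) : ℂ) * b⁻¹ := by rw [div_eq_mul_inv]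
  rw [h2, hpi, ofReal_mul_cpow Real.pi_pos (inv_ne_zero hbne), Complex.inv_cpow _ _ hbarg,
    show (2 * b : ℂ) = ((2 : ℝ) : ℂ) * b by norm_num,
    ofReal_mul_cpow (by norm_num) hbne, Complex.cpow_neg b, ← mul_assoc]
  congr 1
  rw [show (1 / 2 : ℂ) = ((1 / 2 : ℝ) : ℂ) by norm_num, ← Complex.ofReal_neg,
    ← Complex.ofReal_cpow Real.pi_pos.le, ← Complex.ofReal_cpow (by norm_num),
    ← Complex.ofReal_mul, Complex.ofReal_inj, ← Real.sqrt_eq_rpow, Real.rpow_neg (by norm_num),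
    ← Real.sqrt_eq_rpow, Real.sqrt_mul (by norm_num)]
  have : √Real.pi ≠ 0 := by positivity
  field_simp

variable {E : Type*} [NormedAddCommGroup E] [InnerProductSpace ℝ E] [FiniteDimensional ℝ E]
  [MeasurableSpace E] [BorelSpace E]

lemma stdGaussian_map_norm_sq {n : ℕ} (hn : 0 < n) (hE : Module.finrank ℝ E = n) :
    (stdGaussian E).map (fun x => ‖x‖ ^ 2) = gammaMeasure (n / 2) (1 / 2) := by
  have hn' : (0 : ℝ) < n / 2 := by positivity
  have := isProbabilityMeasure_gammaMeasure hn' (show (0 : ℝ) < 1 / 2 by norm_num)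
  have : IsProbabilityMeasure ((stdGaussian E).map (fun x => ‖x‖ ^ 2)) :=
    Measure.isProbabilityMeasure_map (by fun_prop)
  refine Measure.ext_of_charFun ?_
  ext t
  rw [charFun_gammaMeasure hn' (by norm_num), charFun_apply_real,
    integral_map (by fun_prop) (by fun_prop), stdGaussian,
    integral_map (Measurable.aemeasurable (by fun_prop))
      (Measurable.aestronglyMeasurable (by fun_prop))]
  have h (x : Fin (Module.finrank ℝ E) → ℝ) :
      Complex.exp (t * (‖∑ i, x i • stdOrthonormalBasis ℝ E i‖ ^ 2 : ℝ) * Complex.I) =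
        ∏ i, Complex.exp (Complex.I * t * (x i : ℂ) ^ 2) := by
    rw [← Complex.exp_sum, ← (stdOrthonormalBasis ℝ E).sum_sq_norm_inner_right]
    congr 1
    push_cast
    rw [Finset.mul_sum, Finset.sum_mul]
    refine Finset.sum_congr rfl fun i _ => ?_
    rw [(stdOrthonormalBasis ℝ E).orthonormal.inner_right_fintype]
    rw [Real.norm_eq_abs, ← Complex.ofReal_pow, sq_abs]
    push_cast; ring
  simp_rw [h]
  rw [integral_fintype_prod_eq_prod
    (f := fun _ (x : ℝ) => Complex.exp (Complex.I * t * (x : ℂ) ^ 2))]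
  simp_rw [integral_cexp_sq_gaussianReal]
  rw [Finset.prod_const, Finset.card_univ, Fintype.card_fin, hE, ← Complex.cpow_nat_mul]
  congr 1
  · push_cast; ring
  · push_cast; ring

/-- For `t ∈ K`, pairing `t` with the projection of `x` is the same as pairing it with `x`, so the
characteristic functions coincide. -/
lemma stdGaussian_map_orthogonalProjection (K : Submodule ℝ E) :
    (stdGaussian E).map K.orthogonalProjectionOnto = stdGaussian K := by
  have : IsProbabilityMeasure ((stdGaussian E).map K.orthogonalProjectionOnto) :=
    Measure.isProbabilityMeasure_map (by fun_prop)
  refine Measure.ext_of_charFun ?_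
  ext t
  rw [charFun_stdGaussian, charFun_apply, integral_map (by fun_prop) (by fun_prop)]
  have h := charFun_stdGaussian (t : E)
  rw [charFun_apply] at h
  rw [show ‖t‖ = ‖(t : E)‖ from rfl, ← h]
  refine integral_congr_ae (ae_of_all _ fun x => ?_)
  simp only [Submodule.inner_orthogonalProjectionOnto_eq_of_mem_right]

/-- The squared distance of a standard Gaussian vector to a subspace is a chi-square variable. -/
lemma stdGaussian_map_norm_sq_orthogonalProjection {n : ℕ} (hn : 0 < n) (K : Submodule ℝ E)
    (hK : Module.finrank ℝ K = n) :
    (stdGaussian E).map (fun x => ‖K.orthogonalProjectionOnto x‖ ^ 2) =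
      gammaMeasure (n / 2) (1 / 2) := by
  rw [← stdGaussian_map_norm_sq hn hK, ← stdGaussian_map_orthogonalProjection K,
    Measure.map_map (by fun_prop) (by fun_prop)]
  rfl

end ChiSquare

/-! ### Gram matrices and the estimation error -/

section LinearAlgebra

open Matrix

variable {N d m : ℕ}

/-- The quadratic form of the inverse Gram matrix of `Z`. -/
noncomputable def invGramForm (Z : Matrix (Fin N) (Fin d) ℝ) (t : Fin d → ℝ) : ℝ :=
  t ⬝ᵥ ((Zᵀ * Z)⁻¹ *ᵥ t)

lemma invGramForm_mul_transpose (G : Matrix (Fin N) (Fin d) ℝ) {B : Matrix (Fin d) (Fin d) ℝ}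
    (hB : IsUnit B.det) (s : Fin d → ℝ) :
    invGramForm (G * Bᵀ) (B *ᵥ s) = invGramForm G s := by
  have hBt : IsUnit Bᵀ.det := by rwa [det_transpose]
  have h : ((G * Bᵀ)ᵀ * (G * Bᵀ))⁻¹ = B⁻¹ᵀ * (Gᵀ * G)⁻¹ * B⁻¹ := by
    rw [transpose_mul, transpose_transpose, Matrix.mul_assoc, ← Matrix.mul_assoc Gᵀ,
      Matrix.mul_inv_rev, Matrix.mul_inv_rev, transpose_nonsing_inv]
  rw [invGramForm, h, mulVec_mulVec, Matrix.mul_assoc, Matrix.nonsing_inv_mul _ hB,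
    Matrix.mul_one, ← mulVec_mulVec, dotProduct_mulVec, ← mulVec_transpose, transpose_transpose,
    mulVec_mulVec, Matrix.nonsing_inv_mul _ hB, one_mulVec, invGramForm]

lemma invGramForm_single (G : Matrix (Fin N) (Fin (m + 1)) ℝ) (c : ℝ) :
    invGramForm G (Pi.single 0 c) = c ^ 2 * (Gᵀ * G)⁻¹ 0 0 := by
  rw [invGramForm, single_dotProduct, mulVec_single]
  simp
  ring

lemma dotProduct_self_mul_inv_gram (Z : Matrix (Fin N) (Fin d) ℝ) (hZ : IsUnit (Zᵀ * Z).det)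
    (t : Fin d → ℝ) :
    (Z *ᵥ ((Zᵀ * Z)⁻¹ *ᵥ t)) ⬝ᵥ (Z *ᵥ ((Zᵀ * Z)⁻¹ *ᵥ t)) = invGramForm Z t := by
  rw [dotProduct_mulVec, ← mulVec_transpose, mulVec_mulVec, mulVec_mulVec,
    Matrix.mul_nonsing_inv _ hZ, one_mulVec, invGramForm]

open scoped MatrixOrder Matrix.Norms.L2Operator in
-- A factor of `S` is unique only up to an orthogonal matrix on the right. This freedom is used to
-- rotate `A⁻¹t` onto the first coordinate axis, so that `c² = ‖A⁻¹t‖²`.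
lemma exists_factor_of_posDef {S : Matrix (Fin (m + 1)) (Fin (m + 1)) ℝ} (hS : S.PosDef)
    (t : Fin (m + 1) → ℝ) :
    ∃ (B : Matrix (Fin (m + 1)) (Fin (m + 1)) ℝ) (c : ℝ), B * Bᵀ = S ∧ IsUnit B.det ∧
      B *ᵥ Pi.single 0 c = t ∧ c ^ 2 = t ⬝ᵥ (S⁻¹ *ᵥ t) := by
  obtain ⟨A, hA⟩ : ∃ A : Matrix (Fin (m + 1)) (Fin (m + 1)) ℝ, A * Aᵀ = S := by
    obtain ⟨C, hC⟩ := CStarAlgebra.nonneg_iff_eq_mul_star_self.1 hS.posSemidef.nonneg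
    exact ⟨C, by rw [hC, star_eq_conjTranspose, conjTranspose_eq_transpose_of_trivial]⟩
  have hAu : IsUnit A.det := by
    have := hS.det_pos
    rw [← hA, det_mul, det_transpose] at this
    exact isUnit_iff_ne_zero.2 fun h => by simp [h] at this
  set s : EuclideanSpace ℝ (Fin (m + 1)) := WithLp.toLp 2 (A⁻¹ *ᵥ t)
  obtain ⟨b, hb⟩ : ∃ b : OrthonormalBasis (Fin (m + 1)) ℝ (EuclideanSpace ℝ (Fin (m + 1))),
      ∃ c : ℝ, c • b 0 = s := by
    by_cases hs : s = 0
    · exact ⟨EuclideanSpace.basisFun _ ℝ, 0, by simp [hs]⟩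
    have hs' : ‖s‖ ≠ 0 := norm_ne_zero_iff.2 hs
    -- An orthonormal family with a single member, placed at index 0 so that the extended basis has
    -- it as its first vector.
    have ho : Orthonormal ℝ (({0} : Set (Fin (m + 1))).domRestrict fun _ => ‖s‖⁻¹ • s) := by
      refine ⟨fun i => ?_, fun i j hij => absurd (Subsingleton.elim i j) hij⟩
      simp [Set.domRestrict, norm_smul, hs']
    obtain ⟨b, hb⟩ := ho.exists_orthonormalBasis_extension_of_card_eq (by simp)
    refine ⟨b, ‖s‖, ?_⟩
    rw [hb 0 rfl, smul_smul, mul_inv_cancel₀ hs', one_smul]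
  obtain ⟨c, hc⟩ := hb
  set O : Matrix (Fin (m + 1)) (Fin (m + 1)) ℝ := Matrix.of fun i j => b j i
  have hO : Oᵀ * O = 1 := by
    ext i j
    have := orthonormal_iff_ite.1 b.orthonormal j i
    rw [Matrix.mul_apply, one_apply]
    simp only [PiLp.inner_apply, RCLike.inner_apply, conj_trivial] at this
    simp only [O, transpose_apply, of_apply]
    rw [this]
    simp [eq_comm]
  have hO' : O * Oᵀ = 1 := mul_eq_one_comm.1 hO
  have hOu : IsUnit O.det := by
    have := congrArg det hO
    rw [det_mul, det_transpose, det_one] at this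
    exact IsUnit.of_mul_eq_one _ this
  have hBS : A * O * (A * O)ᵀ = S := by
    rw [transpose_mul, Matrix.mul_assoc, ← Matrix.mul_assoc O, hO', Matrix.one_mul, hA]
  have hBt : (A * O) *ᵥ Pi.single 0 c = t := by
    have : O *ᵥ Pi.single 0 c = A⁻¹ *ᵥ t := by
      ext i
      have := congrArg (fun v : EuclideanSpace ℝ (Fin (m + 1)) => v i) hc
      simp only [s, PiLp.smul_apply, smul_eq_mul] at this
      rw [← this, mulVec_single]
      simp [O, mul_comm]
    rw [← mulVec_mulVec, this, mulVec_mulVec, Matrix.mul_nonsing_inv _ hAu, one_mulVec]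
  have hBu : IsUnit (A * O).det := by rw [det_mul]; exact hAu.mul hOu
  refine ⟨A * O, c, hBS, hBu, hBt, ?_⟩
  generalize A * O = B at *
  have hBt' : IsUnit Bᵀ.det := by rwa [det_transpose]
  rw [← hBS, ← hBt, Matrix.mul_inv_rev, mulVec_mulVec, Matrix.mul_assoc,
    Matrix.nonsing_inv_mul _ hBu, Matrix.mul_one, dotProduct_comm, dotProduct_mulVec,
    ← mulVec_transpose, mulVec_mulVec, Matrix.mul_nonsing_inv _ hBt', one_mulVec,
    single_dotProduct]
  simp [sq]

/-- The columns of a matrix as vectors in Euclidean space. -/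
noncomputable def euclideanCol (Y : Fin N → Fin m → ℝ) (j : Fin m) : EuclideanSpace ℝ (Fin N) :=
  WithLp.toLp 2 fun i => Y i j

/-- The matrix with first column `x` and remaining columns `Y`. -/
def consColumn (x : Fin N → ℝ) (Y : Fin N → Fin m → ℝ) : Fin N → Fin (m + 1) → ℝ :=
  fun i => Fin.cons (x i) (Y i)

lemma euclideanCol_consColumn (x : Fin N → ℝ) (Y : Fin N → Fin m → ℝ) :
    euclideanCol (consColumn x Y) = Fin.cons (WithLp.toLp 2 x) (euclideanCol Y) := by
  ext j i
  refine Fin.cases ?_ (fun j => ?_) j <;> simp [euclideanCol, consColumn]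

lemma isUnit_det_gram {Y : Fin N → Fin m → ℝ} (hY : LinearIndependent ℝ (euclideanCol Y)) :
    IsUnit ((Matrix.of Y)ᵀ * Matrix.of Y).det := by
  have hinj : Function.Injective (Matrix.of Y).mulVec := by
    intro u w huw
    have h : ∑ j, (u j - w j) • euclideanCol Y j = 0 := by
      ext i
      have := congrFun huw i
      simp only [mulVec, dotProduct, of_apply] at this
      simp [euclideanCol, mul_comm _ (Y i _), mul_sub, Finset.sum_sub_distrib, this]
    ext j
    exact sub_eq_zero.1 (Fintype.linearIndependent_iff.1 hY _ h j)
  have := (Matrix.PosDef.conjTranspose_mul_self (Matrix.of Y) hinj).det_pos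
  rw [conjTranspose_eq_transpose_of_trivial] at this
  exact isUnit_iff_ne_zero.2 this.ne'

/-- The orthogonal complement of the columns of `Y`. -/
noncomputable def colComplement (Y : Fin N → Fin m → ℝ) :
    Submodule ℝ (EuclideanSpace ℝ (Fin N)) :=
  (Submodule.span ℝ (Set.range (euclideanCol Y)))ᗮ

lemma finrank_colComplement {Y : Fin N → Fin m → ℝ}
    (hY : LinearIndependent ℝ (euclideanCol Y)) :
    Module.finrank ℝ (colComplement Y) = N - m := by
  have h := Submodule.finrank_add_finrank_orthogonal
    (Submodule.span ℝ (Set.range (euclideanCol Y)))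
  rw [finrank_span_eq_card hY, Fintype.card_fin, finrank_euclideanSpace_fin] at h
  rw [colComplement]
  omega

/-- Duality argument: `v = G(GᵀG)⁻¹e₀` pairs to 1 with the first column `X` and to 0 with the
others, so it lies in the complement of `Y`. Its coefficient on `X` is `y₀ = (GᵀG)⁻¹₀₀`. Projecting
gives `v = y₀ P X`, and pairing with `X` gives `y₀ ‖P X‖² = 1`. -/
lemma inv_gram_consColumn_zero_zero (x : Fin N → ℝ) (Y : Fin N → Fin m → ℝ)
    (h : LinearIndependent ℝ (euclideanCol (consColumn x Y))) :
    ((Matrix.of (consColumn x Y))ᵀ * Matrix.of (consColumn x Y))⁻¹ 0 0 =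
      (‖(colComplement Y).orthogonalProjectionOnto (WithLp.toLp 2 x)‖ ^ 2)⁻¹ := by
  have hu := isUnit_det_gram h
  set G := Matrix.of (consColumn x Y) with hG
  set y : Fin (m + 1) → ℝ := (Gᵀ * G)⁻¹ *ᵥ Pi.single 0 1 with hy
  have hy0 : (Gᵀ * G)⁻¹ 0 0 = y 0 := by rw [hy, mulVec_single]; simp
  have hGy : Gᵀ *ᵥ (G *ᵥ y) = Pi.single 0 1 := by
    rw [hy, mulVec_mulVec, mulVec_mulVec, Matrix.mul_nonsing_inv _ hu, one_mulVec]
  set v : EuclideanSpace ℝ (Fin N) := WithLp.toLp 2 (G *ᵥ y) with hv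
  set X : EuclideanSpace ℝ (Fin N) := WithLp.toLp 2 x with hX
  have hin (j : Fin (m + 1)) :
      inner ℝ (euclideanCol (consColumn x Y) j) v = (Pi.single 0 1 : Fin (m + 1) → ℝ) j := by
    rw [← hGy]
    simp only [PiLp.inner_apply, RCLike.inner_apply, conj_trivial, mulVec, dotProduct,
      euclideanCol, hv, hG, transpose_apply, of_apply]
    exact Finset.sum_congr rfl fun i _ => mul_comm _ _
  rw [euclideanCol_consColumn] at hin
  have hin0 : inner ℝ X v = 1 := by simpa using hin 0
  have hvK : v ∈ colComplement Y := by
    rw [colComplement, Submodule.mem_orthogonal]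
    intro u hu
    induction hu using Submodule.span_induction with
    | mem u hu => obtain ⟨j, rfl⟩ := hu; simpa using hin j.succ
    | zero => simp
    | add u w _ _ hu hw => rw [inner_add_left, hu, hw, add_zero]
    | smul a u _ hu => rw [inner_smul_left, hu, mul_zero]
  have hvsum : v = y 0 • X + ∑ j : Fin m, y j.succ • euclideanCol Y j := by
    ext i
    simp [hv, mulVec, dotProduct, Fin.sum_univ_succ, hG, consColumn, euclideanCol, mul_comm, hX]
  set P := (colComplement Y).orthogonalProjectionOnto with hP
  have hPcol (j : Fin m) : P (euclideanCol Y j) = 0 := by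
    rw [hP, Submodule.orthogonalProjectionOnto_eq_zero_iff]
    exact Submodule.le_orthogonal_orthogonal _ (Submodule.subset_span ⟨j, rfl⟩)
  have hPv : P v = y 0 • P X := by
    rw [hvsum, map_add, map_sum, map_smul]
    simp [hPcol]
  have hPv' : (P v : EuclideanSpace ℝ (Fin N)) = v := by
    exact Submodule.starProjection_eq_self_iff.2 hvK
  have hnorm : inner ℝ X (P X : EuclideanSpace ℝ (Fin N)) = ‖P X‖ ^ 2 := by
    rw [← real_inner_self_eq_norm_sq, real_inner_comm]
    exact (Submodule.inner_orthogonalProjectionOnto_eq_of_mem_left (P X) X).symm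
  rw [hy0]
  have : y 0 * ‖P X‖ ^ 2 = 1 := by
    rw [← hnorm, ← inner_smul_right, ← Submodule.coe_smul, ← hPv, hPv', hin0]
  exact eq_inv_of_mul_eq_one_left this

lemma sub_mlEstimator_eq (z : Fin N → EuclideanSpace ℝ (Fin d)) (θ₀ : EuclideanSpace ℝ (Fin d))
    (e : Fin N → ℝ) (hZ : IsUnit ((designMatrix z)ᵀ * designMatrix z).det) :
    θ₀ - mlEstimator (z, (designMatrix z).mulVec θ₀ + e) =
      WithLp.toLp 2 (-(((designMatrix z)ᵀ * designMatrix z)⁻¹ *ᵥ ((designMatrix z)ᵀ *ᵥ e))) := by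
  simp only [mlEstimator]
  rw [mulVec_add, mulVec_add, mulVec_mulVec _ (designMatrix z)ᵀ, mulVec_mulVec,
    Matrix.nonsing_inv_mul _ hZ, one_mulVec]
  ext i
  simp

/-- For fixed covariates each projection of the error is a linear form in the noise, which makes the
noise integral a Gaussian characteristic function. -/
lemma inner_sub_mlEstimator (z : Fin N → EuclideanSpace ℝ (Fin d))
    (θ₀ t : EuclideanSpace ℝ (Fin d)) (e : Fin N → ℝ)
    (hZ : IsUnit ((designMatrix z)ᵀ * designMatrix z).det) :
    inner ℝ (θ₀ - mlEstimator (z, (designMatrix z).mulVec θ₀ + e)) t =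
      e ⬝ᵥ (-(designMatrix z *ᵥ (((designMatrix z)ᵀ * designMatrix z)⁻¹ *ᵥ t))) := by
  rw [sub_mlEstimator_eq z θ₀ e hZ]
  rw [EuclideanSpace.inner_eq_star_dotProduct]
  simp only [star_trivial]
  rw [dotProduct_neg, dotProduct_neg, dotProduct_mulVec, ← mulVec_transpose,
    transpose_nonsing_inv, transpose_mul, transpose_transpose, dotProduct_mulVec,
    ← mulVec_transpose, transpose_transpose, dotProduct_comm]

end LinearAlgebra

/-! ### Gaussian matrices: full rank and the inverse Gram entry -/

section GaussianMatrix

open Matrix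

variable {N d m : ℕ}

/-- The law of an `N × m` matrix with independent standard Gaussian entries. -/
noncomputable abbrev gaussianMatrix (N m : ℕ) : Measure (Fin N → Fin m → ℝ) :=
  Measure.pi fun _ : Fin N => Measure.pi fun _ : Fin m => gaussianReal 0 1

lemma measurePreserving_consColumn (N m : ℕ) :
    MeasurePreserving (fun p : (Fin N → ℝ) × (Fin N → Fin m → ℝ) => consColumn p.1 p.2)
      ((Measure.pi fun _ : Fin N => gaussianReal 0 1).prod (gaussianMatrix N m))
      (gaussianMatrix N (m + 1)) := by
  have h1 := (measurePreserving_arrowProdEquivProdArrow ℝ (Fin m → ℝ) (Fin N)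
    (fun _ => gaussianReal 0 1) (fun _ => Measure.pi fun _ : Fin m => gaussianReal 0 1)).symm
  have h2 := (measurePreserving_piFinSuccAbove (fun _ : Fin (m + 1) => gaussianReal 0 1) 0).symm
  have h3 := measurePreserving_pi
    (fun _ : Fin N => (gaussianReal 0 1).prod (Measure.pi fun _ : Fin m => gaussianReal 0 1))
    (fun _ : Fin N => Measure.pi fun _ : Fin (m + 1) => gaussianReal 0 1) (fun _ => h2)
  have h4 := h3.comp h1
  convert h4 using 1
  ext p i j
  simp [consColumn, MeasurableEquiv.arrowProdEquivProdArrow, Equiv.arrowProdEquivProdArrow,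
    MeasurableEquiv.piFinSuccAbove, Fin.insertNthEquiv]

lemma gaussian_map_norm_sq_colComplement (hm : m < N) {Y : Fin N → Fin m → ℝ}
    (hY : LinearIndependent ℝ (euclideanCol Y)) :
    (Measure.pi fun _ : Fin N => gaussianReal 0 1).map (fun x =>
      ‖(colComplement Y).orthogonalProjectionOnto (WithLp.toLp 2 x)‖ ^ 2) =
        gammaMeasure (((N - m : ℕ) : ℝ) / 2) (1 / 2) := by
  rw [← stdGaussian_map_norm_sq_orthogonalProjection (by omega) _ (finrank_colComplement hY),
    ← map_pi_eq_stdGaussian, Measure.map_map (by fun_prop) (by fun_prop)]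
  rfl

/-- The squared distance from `x` to the span of `Y` is a gamma variable, hence almost surely
positive, so `x` is outside the span. -/
lemma ae_linearIndependent_consColumn (hm : m < N) {Y : Fin N → Fin m → ℝ}
    (hY : LinearIndependent ℝ (euclideanCol Y)) :
    ∀ᵐ x ∂(Measure.pi fun _ : Fin N => gaussianReal 0 1),
      LinearIndependent ℝ (euclideanCol (consColumn x Y)) := by
  have h := ae_pos_gammaMeasure (((N - m : ℕ) : ℝ) / 2) (1 / 2)
  rw [← gaussian_map_norm_sq_colComplement hm hY] at h
  filter_upwards [ae_of_ae_map (by fun_prop) h] with x hx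
  rw [euclideanCol_consColumn, linearIndependent_finCons]
  refine ⟨hY, fun hmem => ?_⟩
  have : (colComplement Y).orthogonalProjectionOnto (WithLp.toLp 2 x) = 0 := by
    rw [Submodule.orthogonalProjectionOnto_eq_zero_iff]
    exact Submodule.le_orthogonal_orthogonal _ hmem
  simp [this] at hx

lemma measurable_inv_apply (i j : Fin d) :
    Measurable fun M : Fin d → Fin d → ℝ => (Matrix.of M)⁻¹ i j := by
  simp_rw [Matrix.inv_def, Ring.inverse_eq_inv', Matrix.smul_apply, smul_eq_mul]
  have h1 : Continuous fun M : Fin d → Fin d → ℝ => (Matrix.of M).det :=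
    Continuous.matrix_det continuous_id
  have h2 : Continuous fun M : Fin d → Fin d → ℝ => (Matrix.of M).adjugate i j :=
    (Continuous.matrix_adjugate continuous_id).matrix_elem i j
  exact h1.measurable.inv.mul h2.measurable

lemma measurable_inv_gram_apply (i j : Fin d) :
    Measurable fun M : Fin N → Fin d → ℝ => ((Matrix.of M)ᵀ * Matrix.of M)⁻¹ i j := by
  have h : Measurable fun M : Fin N → Fin d → ℝ => fun k l => ∑ n, M n k * M n l := by
    fun_prop
  exact (measurable_inv_apply i j).comp h

lemma ae_linearIndependent_gaussianMatrix (N : ℕ) : ∀ m ≤ N,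
    ∀ᵐ Y ∂(gaussianMatrix N m), LinearIndependent ℝ (euclideanCol Y) := by
  intro m
  induction m with
  | zero => exact fun _ => ae_of_all _ fun Y => linearIndependent_empty_type
  | succ m ih =>
    intro hm
    have hcont : Continuous fun Y : Fin N → Fin (m + 1) → ℝ =>
        ((Matrix.of Y)ᵀ * Matrix.of Y).det := by
      refine Continuous.matrix_det ?_
      have h : Continuous fun Y : Fin N → Fin (m + 1) → ℝ => Matrix.of Y := continuous_id
      exact h.matrix_transpose.matrix_mul h
    -- Independence is the nonvanishing of the Gram determinant, an open condition; this supplies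
    -- the measurability needed for Fubini.
    have hset : {Y : Fin N → Fin (m + 1) → ℝ | LinearIndependent ℝ (euclideanCol Y)} =
        {Y | ((Matrix.of Y)ᵀ * Matrix.of Y).det ≠ 0} := by
      ext Y
      refine ⟨fun h => (isUnit_det_gram h).ne_zero, fun h => ?_⟩
      rw [Set.mem_ofPred_eq, Fintype.linearIndependent_iff]
      intro g hg
      have h0 : Matrix.of Y *ᵥ g = 0 := by
        ext i
        have := congrArg (fun v : EuclideanSpace ℝ (Fin N) => v i) hg
        simpa [mulVec, dotProduct, euclideanCol, mul_comm] using this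
      have h1 : ((Matrix.of Y)ᵀ * Matrix.of Y) *ᵥ g = 0 := by
        rw [← mulVec_mulVec, h0, mulVec_zero]
      exact congrFun (Matrix.eq_zero_of_mulVec_eq_zero h h1)
    have hms : MeasurableSet
        {Y : Fin N → Fin (m + 1) → ℝ | LinearIndependent ℝ (euclideanCol Y)} := by
      rw [hset]
      exact (isOpen_ne_fun hcont continuous_const).measurableSet
    have hms' : MeasurableSet {p : (Fin N → ℝ) × (Fin N → Fin m → ℝ) |
        LinearIndependent ℝ (euclideanCol (consColumn p.1 p.2))} :=
      (measurePreserving_consColumn N m).measurable hms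
    rw [← (measurePreserving_consColumn N m).map_eq,
      ae_map_iff (measurePreserving_consColumn N m).measurable.aemeasurable hms,
      Measure.ae_prod_iff_ae_ae hms', Measure.ae_ae_comm hms']
    filter_upwards [ih (by omega)] with Y hY
    exact ae_linearIndependent_consColumn (by omega) hY

/-- The inverse of the corner entry of an inverse Wishart matrix is a chi-square variable. -/
lemma gaussianMatrix_map_inv_gram_zero_zero (hm : m < N) :
    (gaussianMatrix N (m + 1)).map (fun M => ((Matrix.of M)ᵀ * Matrix.of M)⁻¹ 0 0) =
      (gammaMeasure (((N - m : ℕ) : ℝ) / 2) (1 / 2)).map (fun w => w⁻¹) := by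
  have hmp := measurePreserving_consColumn N m
  have hmeas := measurable_inv_gram_apply (N := N) (d := m + 1) 0 0
  ext s hs
  rw [← hmp.map_eq, Measure.map_map hmeas hmp.measurable,
    Measure.map_apply (hmeas.comp hmp.measurable) hs,
    Measure.prod_apply_symm ((hmeas.comp hmp.measurable) hs)]
  -- For almost every `Y`, the conditional law given `Y` depends only on the dimension `N - m` of
  -- the complement, so averaging over `Y` changes nothing.
  have h : ∀ᵐ Y ∂(gaussianMatrix N m), (Measure.pi fun _ : Fin N => gaussianReal 0 1)
      ((fun x => (x, Y)) ⁻¹' (((fun M : Fin N → Fin (m + 1) → ℝ =>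
        ((Matrix.of M)ᵀ * Matrix.of M)⁻¹ 0 0) ∘ fun p => consColumn p.1 p.2) ⁻¹' s)) =
      ((gammaMeasure (((N - m : ℕ) : ℝ) / 2) (1 / 2)).map (fun w => w⁻¹)) s := by
    filter_upwards [ae_linearIndependent_gaussianMatrix N m hm.le] with Y hY
    rw [← gaussian_map_norm_sq_colComplement hm hY, Measure.map_map (by fun_prop) (by fun_prop),
      Measure.map_apply (by fun_prop) hs]
    refine measure_congr ?_
    filter_upwards [ae_linearIndependent_consColumn hm hY] with x hx
    have := inv_gram_consColumn_zero_zero x Y hx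
    exact propext (by
      change ((Matrix.of (consColumn x Y))ᵀ * Matrix.of (consColumn x Y))⁻¹ 0 0 ∈ s ↔
        (‖(colComplement Y).orthogonalProjectionOnto (WithLp.toLp 2 x)‖ ^ 2)⁻¹ ∈ s
      rw [this])
  rw [lintegral_congr_ae h, lintegral_const, measure_univ, mul_one]

lemma stdGaussian_map_mulVec {S B : Matrix (Fin d) (Fin d) ℝ} (hS : S.PosSemidef)
    (hB : B * Bᵀ = S) :
    (Measure.pi fun _ : Fin d => gaussianReal 0 1).map (fun g => WithLp.toLp 2 (B *ᵥ g)) =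
      multivariateGaussian (0 : EuclideanSpace ℝ (Fin d)) S := by
  have hmeas : Measurable fun g : Fin d → ℝ => (WithLp.toLp 2 (B *ᵥ g) :
      EuclideanSpace ℝ (Fin d)) := by
    have : Continuous fun g : Fin d → ℝ => B *ᵥ g := continuous_const.matrix_mulVec continuous_id
    exact (PiLp.continuous_toLp 2 _).measurable.comp this.measurable
  have : IsProbabilityMeasure ((Measure.pi fun _ : Fin d => gaussianReal 0 1).map
      (fun g => (WithLp.toLp 2 (B *ᵥ g) : EuclideanSpace ℝ (Fin d)))) :=
    Measure.isProbabilityMeasure_map hmeas.aemeasurable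
  refine Measure.ext_of_charFun ?_
  ext t
  rw [charFun_multivariateGaussian hS, charFun_apply, integral_map hmeas.aemeasurable
    (Measurable.aestronglyMeasurable (by fun_prop))]
  have h := charFun_stdGaussian (WithLp.toLp 2 (Bᵀ *ᵥ t) : EuclideanSpace ℝ (Fin d))
  rw [← map_pi_eq_stdGaussian, charFun_apply, integral_map (by fun_prop)
    (Measurable.aestronglyMeasurable (by fun_prop))] at h
  have hin (g : Fin d → ℝ) : inner ℝ (WithLp.toLp 2 (B *ᵥ g) : EuclideanSpace ℝ (Fin d)) t =
      inner ℝ (WithLp.toLp 2 g) (WithLp.toLp 2 (Bᵀ *ᵥ t) : EuclideanSpace ℝ (Fin d)) := by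
    simp only [EuclideanSpace.inner_eq_star_dotProduct, star_trivial]
    rw [dotProduct_mulVec, ← mulVec_transpose]
  have hn : ‖(WithLp.toLp 2 (Bᵀ *ᵥ t) : EuclideanSpace ℝ (Fin d))‖ ^ 2 =
      t ⬝ᵥ (S *ᵥ t) := by
    rw [← real_inner_self_eq_norm_sq, EuclideanSpace.inner_eq_star_dotProduct, ← hB]
    simp only [star_trivial]
    rw [dotProduct_mulVec, ← mulVec_transpose, transpose_transpose, mulVec_mulVec, dotProduct_comm]
  simp_rw [hin, h]
  congr 1
  rw [← Complex.ofReal_pow, hn]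
  simp [neg_div]

lemma pi_multivariateGaussian_eq_map (N : ℕ) {S B : Matrix (Fin d) (Fin d) ℝ}
    (hS : S.PosSemidef) (hB : B * Bᵀ = S) :
    (Measure.pi fun _ : Fin N => multivariateGaussian (0 : EuclideanSpace ℝ (Fin d)) S) =
      (gaussianMatrix N d).map fun M i => WithLp.toLp 2 (B *ᵥ M i) := by
  have hmeas : Measurable fun g : Fin d → ℝ => (WithLp.toLp 2 (B *ᵥ g) :
      EuclideanSpace ℝ (Fin d)) := by
    have : Continuous fun g : Fin d → ℝ => B *ᵥ g := continuous_const.matrix_mulVec continuous_id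
    exact (PiLp.continuous_toLp 2 _).measurable.comp this.measurable
  have : SigmaFinite ((Measure.pi fun _ : Fin d => gaussianReal 0 1).map
      (fun g => (WithLp.toLp 2 (B *ᵥ g) : EuclideanSpace ℝ (Fin d)))) := by
    rw [stdGaussian_map_mulVec hS hB]; infer_instance
  rw [gaussianMatrix, Measure.pi_map_pi (f := fun _ g => (WithLp.toLp 2 (B *ᵥ g) :
      EuclideanSpace ℝ (Fin d))) (fun _ => hmeas.aemeasurable), stdGaussian_map_mulVec hS hB]

end GaussianMatrix

/-! ### Characteristic function of the error -/

section ErrorLaw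

open Matrix

variable {N d m : ℕ}

lemma continuous_designMatrix :
    Continuous (designMatrix : (Fin N → EuclideanSpace ℝ (Fin d)) → Matrix (Fin N) (Fin d) ℝ) := by
  refine continuous_matrix fun i j => ?_
  simp only [designMatrix, Matrix.of_apply]
  fun_prop

lemma measurable_mlEstimator : Measurable (mlEstimator : Dataset N d → _) := by
  have hZ (i : Fin N) (j : Fin d) : Measurable fun D : Dataset N d => designMatrix D.1 i j :=
    ((continuous_designMatrix.comp continuous_fst).matrix_elem i j).measurable
  have hZm : Measurable fun D : Dataset N d => fun (i : Fin N) (j : Fin d) =>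
      designMatrix D.1 i j :=
    measurable_pi_iff.2 fun i => measurable_pi_iff.2 fun j => hZ i j
  have hinv (i j : Fin d) : Measurable fun D : Dataset N d =>
      ((designMatrix D.1)ᵀ * designMatrix D.1)⁻¹ i j :=
    (measurable_inv_gram_apply i j).comp hZm
  refine (PiLp.continuous_toLp 2 _).measurable.comp (measurable_pi_iff.2 fun i => ?_)
  simp only [mulVec, dotProduct, transpose_apply]
  refine Finset.measurable_sum _ fun j _ => (hinv i j).mul (Finset.measurable_sum _ fun n _ => ?_)
  exact (hZ n j).mul ((measurable_pi_apply n).comp measurable_snd)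

lemma measurable_dataMap (θ₀ : EuclideanSpace ℝ (Fin d)) :
    Measurable fun p : (Fin N → EuclideanSpace ℝ (Fin d)) × (Fin N → ℝ) =>
      ((p.1, (designMatrix p.1).mulVec θ₀ + p.2) : Dataset N d) := by
  have : Continuous fun p : (Fin N → EuclideanSpace ℝ (Fin d)) × (Fin N → ℝ) =>
      (designMatrix p.1).mulVec θ₀ :=
    (continuous_designMatrix.comp continuous_fst).matrix_mulVec continuous_const
  exact measurable_fst.prodMk (this.measurable.add measurable_snd)

instance (N : ℕ) (S : Matrix (Fin d) (Fin d) ℝ) (θ₀ : EuclideanSpace ℝ (Fin d)) (σ₀ : ℝ) :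
    IsProbabilityMeasure (dataLaw N S θ₀ σ₀) :=
  Measure.isProbabilityMeasure_map (measurable_dataMap θ₀).aemeasurable

lemma integral_cexp_dotProduct_gaussianReal (v : NNReal) (a : Fin N → ℝ) :
    ∫ e, Complex.exp ((e ⬝ᵥ a : ℝ) * Complex.I) ∂(Measure.pi fun _ : Fin N => gaussianReal 0 v) =
      Complex.exp (-(v * (a ⬝ᵥ a) / 2 : ℝ)) := by
  have h := charFun_pi (μ := fun _ : Fin N => gaussianReal 0 v) (WithLp.toLp 2 a)
  rw [charFun_apply, integral_map (by fun_prop) (Measurable.aestronglyMeasurable (by fun_prop))]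
    at h
  simp only [EuclideanSpace.inner_eq_star_dotProduct, star_trivial, charFun_gaussianReal] at h
  simp_rw [dotProduct_comm _ a]
  rw [h, ← Complex.exp_sum]
  congr 1
  simp only [dotProduct]
  push_cast
  rw [Finset.mul_sum, Finset.sum_div, ← Finset.sum_neg_distrib]
  refine Finset.sum_congr rfl fun i _ => ?_
  rw [mul_zero, zero_mul]
  ring

lemma designMatrix_mulVec (M : Fin N → Fin d → ℝ) (B : Matrix (Fin d) (Fin d) ℝ) :
    designMatrix (fun i => (WithLp.toLp 2 (B *ᵥ M i) : EuclideanSpace ℝ (Fin d))) =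
      Matrix.of M * (((√d)⁻¹ : ℝ) • B)ᵀ := by
  ext i j
  simp only [designMatrix, of_apply, mul_apply, transpose_apply, Matrix.smul_apply, smul_eq_mul, mulVec,
    dotProduct, div_eq_inv_mul, Finset.mul_sum]
  exact Finset.sum_congr rfl fun k _ => by ring

lemma isUnit_det_gram_mul_transpose {G : Matrix (Fin N) (Fin d) ℝ} {B : Matrix (Fin d) (Fin d) ℝ}
    (hG : IsUnit (Gᵀ * G).det) (hB : IsUnit B.det) :
    IsUnit ((G * Bᵀ)ᵀ * (G * Bᵀ)).det := by
  rw [transpose_mul, transpose_transpose, Matrix.mul_assoc, ← Matrix.mul_assoc Gᵀ, det_mul,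
    det_mul, det_transpose]
  exact hB.mul (hG.mul hB)

/-- The factor `B` depends on `t`, which is harmless: the law of the covariates is the same for
every factorisation of `S`. Thus one inverse chi-square variable suffices at each `t`. -/
lemma charFun_error {S : Matrix (Fin (m + 1)) (Fin (m + 1)) ℝ} (hS : S.PosDef)
    (θ₀ t : EuclideanSpace ℝ (Fin (m + 1))) (σ₀ : ℝ) (hm : m < N) :
    charFun ((dataLaw N S θ₀ σ₀).map fun D => θ₀ - mlEstimator D) t =
      ∫ w, Complex.exp (-(σ₀ ^ 2 * (m + 1) * (t ⬝ᵥ (S⁻¹ *ᵥ t)) / 2 * w⁻¹ : ℝ))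
        ∂(gammaMeasure (((N - m : ℕ) : ℝ) / 2) (1 / 2)) := by
  obtain ⟨B, c, hBS, hBu, hBt, hc⟩ := exists_factor_of_posDef hS t
  have hd : (0 : ℝ) < √((m + 1 : ℕ) : ℝ) := by positivity
  -- The covariate rescaling `1/√d` is absorbed into the factor; it is the source of the factor `m +
  -- 1 = d` in the exponent.
  set B' := ((√((m + 1 : ℕ) : ℝ))⁻¹ : ℝ) • B with hB'
  have hB'u : IsUnit B'.det := by
    rw [hB', det_smul]
    exact (isUnit_iff_ne_zero.2 (by positivity)).mul hBu
  have hB't : B' *ᵥ Pi.single 0 (√((m + 1 : ℕ) : ℝ) * c) = t := by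
    have hsingle : (Pi.single 0 (√((m + 1 : ℕ) : ℝ) * c) : Fin (m + 1) → ℝ) =
        √((m + 1 : ℕ) : ℝ) • Pi.single 0 c := by
      rw [← Pi.single_smul, smul_eq_mul]
    rw [← hBt, hsingle, hB', mulVec_smul, smul_mulVec, smul_smul, mul_inv_cancel₀ hd.ne', one_smul]
  have hml := measurable_mlEstimator (N := N) (d := m + 1)
  have hdm := measurable_dataMap (N := N) θ₀
  set ν := Measure.pi fun _ : Fin N => gaussianReal 0 (Real.toNNReal (σ₀ ^ 2))
  set F : (Fin N → EuclideanSpace ℝ (Fin (m + 1))) → (Fin N → ℝ) → ℂ := fun z e =>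
    Complex.exp (inner ℝ (θ₀ - mlEstimator (z, (designMatrix z).mulVec θ₀ + e)) t * Complex.I)
    with hF
  have hFm : Measurable fun p : (Fin N → EuclideanSpace ℝ (Fin (m + 1))) × (Fin N → ℝ) =>
      F p.1 p.2 := by
    have : Measurable fun p : (Fin N → EuclideanSpace ℝ (Fin (m + 1))) × (Fin N → ℝ) =>
        mlEstimator ((p.1, (designMatrix p.1).mulVec θ₀ + p.2) : Dataset N (m + 1)) :=
      hml.comp hdm
    fun_prop
  have hmap : Measurable fun (M : Fin N → Fin (m + 1) → ℝ) (i : Fin N) =>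
      (WithLp.toLp 2 (B *ᵥ M i) : EuclideanSpace ℝ (Fin (m + 1))) := by
    refine Continuous.measurable (continuous_pi fun i => (PiLp.continuous_toLp 2 _).comp ?_)
    exact continuous_const.matrix_mulVec (continuous_apply i)
  -- The noise is integrated out first, for covariates with an invertible Gram matrix.
  have hinner : ∀ᵐ M ∂(gaussianMatrix N (m + 1)),
      ∫ e, F (fun i => WithLp.toLp 2 (B *ᵥ M i)) e ∂ν = Complex.exp
        (-(σ₀ ^ 2 * (m + 1) * c ^ 2 / 2 * ((Matrix.of M)ᵀ * Matrix.of M)⁻¹ 0 0 : ℝ)) := by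
    filter_upwards [ae_linearIndependent_gaussianMatrix N (m + 1) hm] with M hM
    have hu := isUnit_det_gram_mul_transpose (isUnit_det_gram hM) hB'u
    have hz := designMatrix_mulVec M B
    rw [← hB'] at hz
    rw [← hz] at hu
    simp only [hF, inner_sub_mlEstimator _ _ _ _ hu, ν]
    rw [integral_cexp_dotProduct_gaussianReal, neg_dotProduct_neg,
      dotProduct_self_mul_inv_gram _ hu, hz, Real.coe_toNNReal _ (sq_nonneg _)]
    have := invGramForm_mul_transpose (Matrix.of M) hB'u (Pi.single 0 (√((m + 1 : ℕ) : ℝ) * c))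
    rw [hB't, invGramForm_single, mul_pow, Real.sq_sqrt (by positivity)] at this
    rw [this]
    congr 3
    push_cast
    ring
  rw [charFun_apply, integral_map (Measurable.aemeasurable (by fun_prop))
    (Measurable.aestronglyMeasurable (by fun_prop)), dataLaw, integral_map hdm.aemeasurable
    (Measurable.aestronglyMeasurable (by fun_prop))]
  have hbound (z e) : ‖F z e‖ ≤ 1 := by
    simp only [hF, Complex.norm_exp_ofReal_mul_I, le_refl]
  have hFi : Integrable (fun p : (Fin N → EuclideanSpace ℝ (Fin (m + 1))) × (Fin N → ℝ) =>
      F p.1 p.2) ((Measure.pi fun _ : Fin N =>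
        multivariateGaussian (0 : EuclideanSpace ℝ (Fin (m + 1))) S).prod ν) :=
    Integrable.of_bound hFm.aestronglyMeasurable 1 (ae_of_all _ fun p => hbound p.1 p.2)
  have h1 := integral_prod _ hFi
  simp only at h1
  refine h1.trans ?_
  rw [pi_multivariateGaussian_eq_map N hS.posSemidef hBS, integral_map hmap.aemeasurable
    hFm.stronglyMeasurable.integral_prod_right.aestronglyMeasurable, integral_congr_ae hinner,
    ← hc]
  have hg : Continuous fun v : ℝ =>
      Complex.exp (-(σ₀ ^ 2 * (m + 1) * c ^ 2 / 2 * v : ℝ)) := by fun_prop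
  have hgm : Measurable fun v : ℝ => v⁻¹ := measurable_inv
  have h2 := integral_map (μ := gaussianMatrix N (m + 1))
    (measurable_inv_gram_apply (0 : Fin (m + 1)) 0).aemeasurable hg.aestronglyMeasurable
  have h3 := integral_map (μ := gammaMeasure (((N - m : ℕ) : ℝ) / 2) (1 / 2)) hgm.aemeasurable
    hg.aestronglyMeasurable
  rw [gaussianMatrix_map_inv_gram_zero_zero hm, h3] at h2
  exact h2.symm

end ErrorLaw

/-! ### Quadratic forms and traces in an eigenbasis -/

section Spectral

open Matrix

variable {d : ℕ} {A : Matrix (Fin d) (Fin d) ℝ} {c : Fin d → ℝ}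
  {b : OrthonormalBasis (Fin d) ℝ (EuclideanSpace ℝ (Fin d))}

lemma dotProduct_mulVec_of_eigenbasis (h : ∀ l, A *ᵥ b l = c l • (b l).ofLp)
    (t : EuclideanSpace ℝ (Fin d)) :
    t ⬝ᵥ (A *ᵥ t) = ∑ l, c l * inner ℝ (b l) t ^ 2 := by
  have ht : t.ofLp = ∑ l, inner ℝ (b l) t • (b l).ofLp := by
    conv_lhs => rw [← b.sum_repr' t]
    simp
  have hin (l) : t ⬝ᵥ (b l).ofLp = inner ℝ (b l) t := by
    simp [EuclideanSpace.inner_eq_star_dotProduct]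
  rw [show A *ᵥ t.ofLp = A *ᵥ ∑ l, inner ℝ (b l) t • (b l).ofLp from congrArg _ ht,
    mulVec_sum, dotProduct_sum]
  refine Finset.sum_congr rfl fun l _ => ?_
  rw [mulVec_smul, h, dotProduct_smul, dotProduct_smul, hin]
  simp only [smul_eq_mul]
  ring

lemma trace_eq_sum_of_eigenbasis (h : ∀ l, A *ᵥ b l = c l • (b l).ofLp) :
    A.trace = ∑ l, c l := by
  have h1 (i : Fin d) : A i i = ∑ l, c l * b l i ^ 2 := by
    have := dotProduct_mulVec_of_eigenbasis h (EuclideanSpace.single i 1)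
    simpa [EuclideanSpace.inner_single_right] using this
  simp only [trace, diag_apply, h1]
  rw [Finset.sum_comm]
  refine Finset.sum_congr rfl fun l _ => ?_
  have : ∑ i, b l i ^ 2 = 1 := by
    rw [← EuclideanSpace.real_norm_sq_eq, b.orthonormal.1 l, one_pow]
  rw [← Finset.mul_sum, this, mul_one]

variable {S : Matrix (Fin d) (Fin d) ℝ}

lemma inv_mulVec_eigenvectorBasis (hS : S.PosDef) (l : Fin d) :
    S⁻¹ *ᵥ (hS.isHermitian.eigenvectorBasis l) =
      (hS.isHermitian.eigenvalues l)⁻¹ • (hS.isHermitian.eigenvectorBasis l).ofLp := by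
  have h := hS.isHermitian.mulVec_eigenvectorBasis l
  have hpos := hS.eigenvalues_pos l
  have hu : IsUnit S.det := isUnit_iff_ne_zero.2 hS.det_pos.ne'
  have h2 := congrArg (S⁻¹ *ᵥ ·) h
  simp only [mulVec_mulVec, Matrix.nonsing_inv_mul _ hu, one_mulVec, mulVec_smul] at h2
  conv_rhs => rw [h2]
  rw [smul_smul, inv_mul_cancel₀ hpos.ne', one_smul]

lemma trace_inv_eq_sum (hS : S.PosDef) :
    S⁻¹.trace = ∑ l, (hS.isHermitian.eigenvalues l)⁻¹ :=
  trace_eq_sum_of_eigenbasis (inv_mulVec_eigenvectorBasis hS)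

lemma trace_inv_sq_eq_sum (hS : S.PosDef) :
    (S⁻¹ ^ 2).trace = ∑ l, (hS.isHermitian.eigenvalues l)⁻¹ ^ 2 := by
  refine trace_eq_sum_of_eigenbasis (b := hS.isHermitian.eigenvectorBasis) fun l => ?_
  rw [sq, ← mulVec_mulVec, inv_mulVec_eigenvectorBasis hS, mulVec_smul,
    inv_mulVec_eigenvectorBasis hS, smul_smul, sq]

end Spectral

/-! ### Moments of weighted sums of squared normals -/

section Moments

lemma gaussianReal_map_sq :
    (gaussianReal 0 1).map (fun x => x ^ 2) = gammaMeasure (1 / 2) (1 / 2) := by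
  have := isProbabilityMeasure_gammaMeasure (show (0 : ℝ) < 1 / 2 by norm_num)
    (show (0 : ℝ) < 1 / 2 by norm_num)
  have : IsProbabilityMeasure ((gaussianReal 0 1).map (fun x : ℝ => x ^ 2)) :=
    Measure.isProbabilityMeasure_map (by fun_prop)
  refine Measure.ext_of_charFun ?_
  ext t
  rw [charFun_gammaMeasure (by norm_num) (by norm_num), charFun_apply_real,
    integral_map (by fun_prop) (by fun_prop)]
  have h := integral_cexp_sq_gaussianReal t
  convert h using 2
  · ext x
    congr 1
    push_cast; ring
  · push_cast; ring
  · push_cast; ring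

lemma integral_sq_gaussianReal : ∫ x : ℝ, x ^ 2 ∂(gaussianReal 0 1) = 1 := by
  have h := integral_rpow_mul_exp_gammaMeasure (a := 1 / 2) (r := 1 / 2) (s := 1) (t := 0)
    (by norm_num) (by norm_num) (by norm_num) (by norm_num)
  simp only [Real.rpow_one, zero_mul, Real.exp_zero, mul_one, sub_zero] at h
  rw [← gaussianReal_map_sq, integral_map (by fun_prop) (by fun_prop),
    Real.Gamma_add_one (by norm_num)] at h
  rw [h]
  have : 0 < Real.Gamma (1 / 2) := Real.Gamma_pos_of_pos (by norm_num)
  have h2 : ((1 : ℝ) / 2) ^ ((1 : ℝ) / 2) ≠ 0 := by positivity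
  rw [Real.rpow_add (by norm_num), Real.rpow_one, one_div_one_div,
    show (2 : ℝ) ^ ((1 : ℝ) / 2) = ((1 / 2) ^ ((1 : ℝ) / 2))⁻¹ by
      rw [← Real.inv_rpow (by norm_num)]; norm_num]
  field_simp

lemma integral_pow_four_gaussianReal : ∫ x : ℝ, (x ^ 2) ^ 2 ∂(gaussianReal 0 1) = 3 := by
  have h := integral_rpow_mul_exp_gammaMeasure (a := 1 / 2) (r := 1 / 2) (s := 2) (t := 0)
    (by norm_num) (by norm_num) (by norm_num) (by norm_num)
  simp only [Real.rpow_two, zero_mul, Real.exp_zero, mul_one, sub_zero] at h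
  rw [← gaussianReal_map_sq, integral_map (by fun_prop) (by fun_prop),
    show (1 / 2 + 2 : ℝ) = 1 / 2 + 1 + 1 by norm_num,
    Real.Gamma_add_one (by norm_num), Real.Gamma_add_one (by norm_num)] at h
  rw [h]
  have : 0 < Real.Gamma (1 / 2) := Real.Gamma_pos_of_pos (by norm_num)
  have h2 : ((1 : ℝ) / 2) ^ ((1 : ℝ) / 2) ≠ 0 := by positivity
  rw [Real.rpow_add (by norm_num), Real.rpow_add (by norm_num), Real.rpow_one, one_div_one_div,
    show (2 : ℝ) ^ ((1 : ℝ) / 2) = ((1 / 2) ^ ((1 : ℝ) / 2))⁻¹ by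
      rw [← Real.inv_rpow (by norm_num)]; norm_num]
  field_simp
  norm_num

lemma memLp_sq_gaussianReal : MemLp (fun x : ℝ => x ^ 2) 2 (gaussianReal 0 1) := by
  rw [memLp_two_iff_integrable_sq (by fun_prop)]
  -- The integral of a non-integrable function is 0 by convention, whereas the fourth moment is 3.
  refine not_not.1 fun h => ?_
  have := integral_pow_four_gaussianReal
  rw [integral_undef h] at this
  norm_num at this

lemma variance_sq_gaussianReal : variance (fun x : ℝ => x ^ 2) (gaussianReal 0 1) = 2 := by
  rw [variance_eq_sub memLp_sq_gaussianReal]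
  simp only [Pi.pow_apply]
  rw [integral_pow_four_gaussianReal, integral_sq_gaussianReal]
  norm_num

variable {d : ℕ} (a : Fin d → ℝ)

lemma memLp_sum_mul_sq : MemLp (fun h : Fin d → ℝ => ∑ l, a l * h l ^ 2) 2
    (Measure.pi fun _ : Fin d => gaussianReal 0 1) :=
  memLp_finsetSum _ fun l _ => (memLp_sq_gaussianReal.const_mul (a l)).comp_measurePreserving
    (measurePreserving_eval (fun _ : Fin d => gaussianReal 0 1) l)

lemma integral_sum_mul_sq : ∫ h : Fin d → ℝ, ∑ l, a l * h l ^ 2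
    ∂(Measure.pi fun _ : Fin d => gaussianReal 0 1) = ∑ l, a l := by
  have hmp := measurePreserving_eval (fun _ : Fin d => gaussianReal 0 1)
  rw [integral_finsetSum]
  · refine Finset.sum_congr rfl fun l _ => ?_
    have h1 := (hmp l).map_eq ▸ integral_map (μ := Measure.pi fun _ : Fin d => gaussianReal 0 1)
      (φ := Function.eval l) (f := fun x : ℝ => a l * x ^ 2) (measurable_pi_apply l).aemeasurable (by fun_prop)
    simp only [Function.eval] at h1
    rw [← h1, integral_const_mul, integral_sq_gaussianReal, mul_one]
  · intro l _
    exact ((memLp_sq_gaussianReal.const_mul (a l)).comp_measurePreserving (hmp l)).integrable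
      (by norm_num)

/-- Squared mean plus variance. By independence the variances `2 aₗ²` add up. -/
lemma integral_sum_mul_sq_sq : ∫ h : Fin d → ℝ, (∑ l, a l * h l ^ 2) ^ 2
    ∂(Measure.pi fun _ : Fin d => gaussianReal 0 1) = (∑ l, a l) ^ 2 + 2 * ∑ l, a l ^ 2 := by
  have h1 := variance_eq_sub (memLp_sum_mul_sq a)
  have h2 := variance_sum_pi (μ := fun _ : Fin d => gaussianReal 0 1)
    (X := fun l x => a l * x ^ 2) fun l => memLp_sq_gaussianReal.const_mul (a l)
  have h3 : (∑ l, fun h : Fin d → ℝ => a l * h l ^ 2) = fun h => ∑ l, a l * h l ^ 2 := by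
    ext h; simp
  rw [h3] at h2
  simp only [variance_const_mul, variance_sq_gaussianReal] at h2
  rw [h2, integral_sum_mul_sq] at h1
  simp only [Pi.pow_apply] at h1
  rw [← Finset.sum_mul] at h1
  linarith

end Moments

/-! ### The error as a Gaussian scale mixture -/

section ErrorLaw

variable {N m : ℕ} {S : Matrix (Fin (m + 1)) (Fin (m + 1)) ℝ}

open Matrix

/-- The law of a normalised chi-square variable with `ν` degrees of freedom. -/
noncomputable abbrev normalizedChiSq (ν : ℕ) : Measure ℝ := gammaMeasure ((ν : ℝ) / 2) ((ν : ℝ) / 2)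

/-- The weight of the `l`-th eigendirection in the square error. -/
noncomputable def errorWeight (N : ℕ) (hS : S.PosDef) (σ₀ : ℝ) (l : Fin (m + 1)) : ℝ :=
  σ₀ ^ 2 * (m + 1) / ((N - m : ℕ) * hS.isHermitian.eigenvalues l)

lemma errorWeight_nonneg (hS : S.PosDef) (σ₀ : ℝ) (l : Fin (m + 1)) :
    0 ≤ errorWeight N hS σ₀ l := by
  have := hS.eigenvalues_pos l
  unfold errorWeight
  positivity

/-- A Gaussian scale mixture with the law of `θ₀ - θ̂_ML`. -/
noncomputable def errorModel (N : ℕ) (hS : S.PosDef) (σ₀ : ℝ) (p : ℝ × (Fin (m + 1) → ℝ)) :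
    EuclideanSpace ℝ (Fin (m + 1)) :=
  ∑ l, (√(errorWeight N hS σ₀ l * p.1⁻¹) * p.2 l) • hS.isHermitian.eigenvectorBasis l

lemma measurable_errorModel (hS : S.PosDef) (σ₀ : ℝ) : Measurable (errorModel N hS σ₀) := by
  unfold errorModel
  fun_prop

lemma norm_sq_errorModel (hS : S.PosDef) (σ₀ : ℝ) {p : ℝ × (Fin (m + 1) → ℝ)} (hp : 0 < p.1) :
    ‖errorModel N hS σ₀ p‖ ^ 2 = p.1⁻¹ * ∑ l, errorWeight N hS σ₀ l * p.2 l ^ 2 := by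
  rw [← hS.isHermitian.eigenvectorBasis.sum_sq_norm_inner_right, Finset.mul_sum]
  refine Finset.sum_congr rfl fun l _ => ?_
  have := errorWeight_nonneg (N := N) hS σ₀ l
  rw [errorModel, hS.isHermitian.eigenvectorBasis.orthonormal.inner_right_fintype,
    Real.norm_eq_abs, sq_abs, mul_pow, Real.sq_sqrt (by positivity)]
  ring

/-- Given `w`, the model is Gaussian with covariance proportional to `w⁻¹ S⁻¹`, so its
characteristic function agrees with `charFun_error`. The match holds for all `t` at once, hence for
the joint law of the coordinates and so for the norm. -/
theorem map_error_eq (hS : S.PosDef) (θ₀ : EuclideanSpace ℝ (Fin (m + 1))) (σ₀ : ℝ) (hm : m < N) :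
    (dataLaw N S θ₀ σ₀).map (fun D => θ₀ - mlEstimator D) =
      ((normalizedChiSq (N - m)).prod (Measure.pi fun _ : Fin (m + 1) => gaussianReal 0 1)).map
        (errorModel N hS σ₀) := by
  have hν : (0 : ℝ) < (N - m : ℕ) := by exact_mod_cast Nat.sub_pos_of_lt hm
  have hν2 : (0 : ℝ) < ((N - m : ℕ) : ℝ) / 2 := by positivity
  have := isProbabilityMeasure_gammaMeasure hν2 hν2
  have hml := measurable_mlEstimator (N := N) (d := m + 1)
  have hT := measurable_errorModel (N := N) hS σ₀
  have : IsProbabilityMeasure ((dataLaw N S θ₀ σ₀).map (fun D => θ₀ - mlEstimator D)) :=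
    Measure.isProbabilityMeasure_map (by fun_prop)
  have : IsProbabilityMeasure (((normalizedChiSq (N - m)).prod
      (Measure.pi fun _ : Fin (m + 1) => gaussianReal 0 1)).map (errorModel N hS σ₀)) :=
    Measure.isProbabilityMeasure_map hT.aemeasurable
  refine Measure.ext_of_charFun ?_
  ext t
  -- A chi-square variable is `N - m` times its normalised version; this constant is the denominator
  -- in `errorWeight`.
  have hg : gammaMeasure (((N - m : ℕ) : ℝ) / 2) (1 / 2) =
      (normalizedChiSq (N - m)).map (((N - m : ℕ) : ℝ) * ·) := by
    rw [gammaMeasure_map_mul hν2 hν2 hν]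
    congr 1
    field_simp
  rw [charFun_error hS θ₀ t σ₀ hm, hg, integral_map (by fun_prop)
    (Measurable.aestronglyMeasurable (by fun_prop)), charFun_apply, integral_map hT.aemeasurable
    (Measurable.aestronglyMeasurable (by fun_prop)), integral_prod]
  swap
  · refine Integrable.of_bound (Measurable.aestronglyMeasurable (by fun_prop)) 1
      (ae_of_all _ fun p => ?_)
    rw [Complex.norm_exp_ofReal_mul_I]
  refine integral_congr_ae ?_
  filter_upwards [ae_pos_gammaMeasure _ _] with w hw
  have hin (h : Fin (m + 1) → ℝ) : inner ℝ (errorModel N hS σ₀ (w, h)) t =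
      h ⬝ᵥ fun l => √(errorWeight N hS σ₀ l * w⁻¹) *
        inner ℝ (hS.isHermitian.eigenvectorBasis l) t := by
    rw [errorModel, sum_inner]
    refine Finset.sum_congr rfl fun l _ => ?_
    rw [real_inner_smul_left]
    ring
  simp only [hin]
  rw [integral_cexp_dotProduct_gaussianReal,
    dotProduct_mulVec_of_eigenbasis (inv_mulVec_eigenvectorBasis hS) t]
  congr 3
  rw [NNReal.coe_one, one_mul, dotProduct, Finset.mul_sum, Finset.sum_div, Finset.sum_mul,
    Finset.sum_div]
  refine Finset.sum_congr rfl fun l _ => ?_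
  have hnn := errorWeight_nonneg (N := N) hS σ₀ l
  rw [mul_mul_mul_comm (√(errorWeight N hS σ₀ l * w⁻¹)), Real.mul_self_sqrt (by positivity),
    errorWeight]
  have := (hS.eigenvalues_pos l).ne'
  field_simp

theorem map_norm_sq_error_eq (hS : S.PosDef) (θ₀ : EuclideanSpace ℝ (Fin (m + 1))) (σ₀ : ℝ)
    (hm : m < N) :
    (dataLaw N S θ₀ σ₀).map (fun D => ‖θ₀ - mlEstimator D‖ ^ 2) =
      ((normalizedChiSq (N - m)).prod (Measure.pi fun _ : Fin (m + 1) => gaussianReal 0 1)).map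
        fun p => p.1⁻¹ * ∑ l, errorWeight N hS σ₀ l * p.2 l ^ 2 := by
  have hν2 : (0 : ℝ) < ((N - m : ℕ) : ℝ) / 2 := by
    have : (0 : ℝ) < (N - m : ℕ) := by exact_mod_cast Nat.sub_pos_of_lt hm
    positivity
  have := isProbabilityMeasure_gammaMeasure hν2 hν2
  have hml := measurable_mlEstimator (N := N) (d := m + 1)
  have hT := measurable_errorModel (N := N) hS σ₀
  have h := congrArg (fun μ => μ.map (fun u => ‖u‖ ^ 2)) (map_error_eq hS θ₀ σ₀ hm)
  rw [Measure.map_map (by fun_prop) (by fun_prop), Measure.map_map (by fun_prop) hT] at h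
  refine h.trans (Measure.map_congr ?_)
  have hpos := Measure.quasiMeasurePreserving_fst (μ := normalizedChiSq (N - m))
    (ν := Measure.pi fun _ : Fin (m + 1) => gaussianReal 0 1) |>.ae (ae_pos_gammaMeasure _ _)
  filter_upwards [hpos] with p hp
  exact norm_sq_errorModel hS σ₀ hp

end ErrorLaw

/-! ### Exact characteristic function, mean and variance -/

section ExactResults

variable {N m : ℕ} {S : Matrix (Fin (m + 1)) (Fin (m + 1)) ℝ}

lemma gammaDensity_eq {ν ω : ℝ} (hν : 0 < ν) :
    gammaDensity ν ω =
      (ν / 2) ^ (ν / 2) / Real.Gamma (ν / 2) * ω ^ (ν / 2 - 1) * Real.exp (-(ν / 2 * ω)) := by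
  rw [gammaDensity, Real.div_rpow hν.le (by norm_num), div_div,
    show (ν - 2) / 2 = ν / 2 - 1 by ring, show -(ν * ω) / 2 = -(ν / 2 * ω) by ring]

/-- Each factor comes from its own one-dimensional Gaussian integral, so the product is one of
principal powers and no branch has to be tracked. Integrability in `ω` comes from Fubini applied to
an integrand of modulus 1. -/
lemma integral_cexp_weighted_chiSq {ν d : ℕ} (hν : 0 < ν) (a : Fin d → ℝ) (α : ℝ) :
    Integrable (fun ω : ℝ => ∏ l : Fin d,
        (1 - 2 * Complex.I * (α * (ω⁻¹ * a l) : ℝ)) ^ (-(1 / 2) : ℂ)) (normalizedChiSq ν) ∧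
      ∫ p : ℝ × (Fin d → ℝ),
        Complex.exp (Complex.I * α * ((p.1⁻¹ * ∑ l, a l * p.2 l ^ 2 : ℝ) : ℂ))
        ∂((normalizedChiSq ν).prod (Measure.pi fun _ : Fin d => gaussianReal 0 1)) =
      ∫ ω, ∏ l : Fin d, (1 - 2 * Complex.I * (α * (ω⁻¹ * a l) : ℝ)) ^ (-(1 / 2) : ℂ)
        ∂(normalizedChiSq ν) := by
  have hν2 : (0 : ℝ) < (ν : ℝ) / 2 := by positivity
  have := isProbabilityMeasure_gammaMeasure hν2 hν2
  have hint : Integrable (fun p : ℝ × (Fin d → ℝ) =>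
      Complex.exp (Complex.I * α * ((p.1⁻¹ * ∑ l, a l * p.2 l ^ 2 : ℝ) : ℂ)))
      ((normalizedChiSq ν).prod (Measure.pi fun _ : Fin d => gaussianReal 0 1)) := by
    refine Integrable.of_bound (Measurable.aestronglyMeasurable (by fun_prop)) 1
      (ae_of_all _ fun p => ?_)
    rw [mul_assoc, ← Complex.ofReal_mul, mul_comm, Complex.norm_exp_ofReal_mul_I]
  have hω (ω : ℝ) : ∫ h : Fin d → ℝ,
      Complex.exp (Complex.I * α * ((ω⁻¹ * ∑ l, a l * h l ^ 2 : ℝ) : ℂ))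
        ∂(Measure.pi fun _ : Fin d => gaussianReal 0 1) =
      ∏ l : Fin d, (1 - 2 * Complex.I * (α * (ω⁻¹ * a l) : ℝ)) ^ (-(1 / 2) : ℂ) := by
    have hexp (h : Fin d → ℝ) :
        Complex.exp (Complex.I * α * ((ω⁻¹ * ∑ l, a l * h l ^ 2 : ℝ) : ℂ)) =
          ∏ l, Complex.exp (Complex.I * (α * (ω⁻¹ * a l) : ℝ) * (h l : ℂ) ^ 2) := by
      rw [← Complex.exp_sum]
      congr 1
      push_cast
      rw [Finset.mul_sum, Finset.mul_sum]
      exact Finset.sum_congr rfl fun l _ => by ring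
    simp_rw [hexp]
    rw [integral_fintype_prod_eq_prod
      (f := fun l (x : ℝ) => Complex.exp (Complex.I * (α * (ω⁻¹ * a l) : ℝ) * (x : ℂ) ^ 2))]
    simp_rw [integral_cexp_sq_gaussianReal]
  refine ⟨?_, ?_⟩
  · have := hint.integral_prod_left
    simpa only [hω] using this
  · rw [integral_prod _ hint]
    simp only [hω]

lemma identDistrib_norm_sq_error (hS : S.PosDef) (θ₀ : EuclideanSpace ℝ (Fin (m + 1))) (σ₀ : ℝ)
    (hm : m < N) :
    IdentDistrib (fun D => ‖θ₀ - mlEstimator D‖ ^ 2)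
      (fun p => p.1⁻¹ * ∑ l, errorWeight N hS σ₀ l * p.2 l ^ 2) (dataLaw N S θ₀ σ₀)
      ((normalizedChiSq (N - m)).prod (Measure.pi fun _ : Fin (m + 1) => gaussianReal 0 1)) := by
  have hml := measurable_mlEstimator (N := N) (d := m + 1)
  exact ⟨by fun_prop, by fun_prop, map_norm_sq_error_eq hS θ₀ σ₀ hm⟩

lemma one_sub_weight_eq (hS : S.PosDef) (σ₀ α ω : ℝ) (hm : m < N) (l : Fin (m + 1)) :
    (1 - Complex.I * α * 2 * ratio N (m + 1) * σ₀ ^ 2 /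
        (ω * (1 - ratio N (m + 1) + 1 / N) * hS.isHermitian.eigenvalues l) : ℂ) =
      1 - 2 * Complex.I * (α * (ω⁻¹ * errorWeight N hS σ₀ l) : ℝ) := by
  have hN : (N : ℂ) ≠ 0 := by exact_mod_cast (by omega : N ≠ 0)
  have h1 : (1 - ratio N (m + 1) + 1 / N : ℂ) = (N - m : ℂ) / N := by
    rw [ratio]
    push_cast
    field_simp
    ring
  rw [h1, errorWeight, ratio, Nat.cast_sub hm.le]
  push_cast
  -- At `ω = 0` both sides equal 1 by the convention for division by zero.
  by_cases hω : (ω : ℂ) = 0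
  · simp [hω]
  have hNm : (N - m : ℂ) ≠ 0 := by
    rw [← Nat.cast_sub hm.le]
    exact_mod_cast (Nat.sub_pos_of_lt hm).ne'
  have hl : (hS.isHermitian.eigenvalues l : ℂ) ≠ 0 := by exact_mod_cast (hS.eigenvalues_pos l).ne'
  field_simp

theorem characteristicFunction_norm_sq_error (hS : S.PosDef)
    (θ₀ : EuclideanSpace ℝ (Fin (m + 1))) (σ₀ : ℝ) (hm : m < N) (α : ℝ) :
    IntegrableOn (fun ω : ℝ =>
      (gammaDensity ((N : ℝ) + 1 - (m + 1 : ℕ)) ω : ℂ) *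
        ∏ l : Fin (m + 1), (1 - Complex.I * α * 2 * ratio N (m + 1) * σ₀ ^ 2 /
          (ω * (1 - ratio N (m + 1) + 1 / N) * hS.isHermitian.eigenvalues l)) ^
            (-(1 / 2) : ℂ)) (Set.Ioi 0) ∧
    ∫ D, Complex.exp (Complex.I * α * ((‖θ₀ - mlEstimator D‖ ^ 2 : ℝ) : ℂ))
        ∂(dataLaw N S θ₀ σ₀) =
      ∫ ω in Set.Ioi (0 : ℝ),
        (gammaDensity ((N : ℝ) + 1 - (m + 1 : ℕ)) ω : ℂ) *
          ∏ l : Fin (m + 1), (1 - Complex.I * α * 2 * ratio N (m + 1) * σ₀ ^ 2 /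
            (ω * (1 - ratio N (m + 1) + 1 / N) *
              hS.isHermitian.eigenvalues l)) ^ (-(1 / 2) : ℂ) := by
  have hν : (0 : ℝ) < (N - m : ℕ) := by exact_mod_cast Nat.sub_pos_of_lt hm
  have hν2 : (0 : ℝ) < ((N - m : ℕ) : ℝ) / 2 := by positivity
  obtain ⟨h1, h2⟩ := integral_cexp_weighted_chiSq (Nat.sub_pos_of_lt hm)
    (errorWeight N hS σ₀) α
  have hden : ((N : ℝ) + 1 - (m + 1 : ℕ)) = (N - m : ℕ) := by
    rw [Nat.cast_sub hm.le]; push_cast; ring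
  have hintegrand : (fun ω : ℝ => (gammaDensity ((N : ℝ) + 1 - (m + 1 : ℕ)) ω : ℂ) *
      ∏ l : Fin (m + 1), (1 - Complex.I * α * 2 * ratio N (m + 1) * σ₀ ^ 2 /
        (ω * (1 - ratio N (m + 1) + 1 / N) * hS.isHermitian.eigenvalues l)) ^ (-(1 / 2) : ℂ)) =
      fun ω => ((((N - m : ℕ) : ℝ) / 2) ^ (((N - m : ℕ) : ℝ) / 2) /
        Real.Gamma (((N - m : ℕ) : ℝ) / 2) * ω ^ (((N - m : ℕ) : ℝ) / 2 - 1) *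
          Real.exp (-(((N - m : ℕ) : ℝ) / 2 * ω))) • ∏ l : Fin (m + 1),
            (1 - 2 * Complex.I * (α * (ω⁻¹ * errorWeight N hS σ₀ l) : ℝ)) ^ (-(1 / 2) : ℂ) := by
    ext ω
    simp only [one_sub_weight_eq hS σ₀ α ω hm]
    rw [hden, gammaDensity_eq hν, Complex.real_smul]
  rw [hintegrand]
  refine ⟨(integrable_gammaMeasure_iff hν2 hν2 _).1 h1, ?_⟩
  rw [← integral_gammaMeasure hν2 hν2, ← h2]
  have hc : Measurable fun x : ℝ => Complex.exp (Complex.I * α * (x : ℂ)) := by fun_prop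
  exact ((identDistrib_norm_sq_error hS θ₀ σ₀ hm).comp hc).integral_eq

lemma identDistrib_mse (hS : S.PosDef) (θ₀ : EuclideanSpace ℝ (Fin (m + 1))) (σ₀ : ℝ)
    (hm : m < N) :
    IdentDistrib (mse θ₀)
      (fun p => p.1⁻¹ * ∑ l, errorWeight N hS σ₀ l / (m + 1) * p.2 l ^ 2) (dataLaw N S θ₀ σ₀)
      ((normalizedChiSq (N - m)).prod (Measure.pi fun _ : Fin (m + 1) => gaussianReal 0 1)) := by
  have h := (identDistrib_norm_sq_error hS θ₀ σ₀ hm).comp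
    (measurable_id.div_const ((m + 1 : ℕ) : ℝ))
  convert h using 1
  · ext p
    simp [mse]
  ext p
  simp only [Function.comp_apply, id, Nat.cast_add, Nat.cast_one]
  rw [mul_div_assoc, Finset.sum_div]
  congr 1
  exact Finset.sum_congr rfl fun l _ => by ring

lemma sum_errorWeight_div (hS : S.PosDef) (σ₀ : ℝ) :
    ∑ l, errorWeight N hS σ₀ l / (m + 1) = σ₀ ^ 2 / (N - m : ℕ) * S⁻¹.trace := by
  rw [trace_inv_eq_sum hS, Finset.mul_sum]
  refine Finset.sum_congr rfl fun l _ => ?_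
  have : (m + 1 : ℝ) ≠ 0 := by positivity
  rw [errorWeight, div_mul_eq_div_div]
  field_simp

lemma sum_errorWeight_div_sq (hS : S.PosDef) (σ₀ : ℝ) :
    ∑ l, (errorWeight N hS σ₀ l / (m + 1)) ^ 2 =
      (σ₀ ^ 2 / (N - m : ℕ)) ^ 2 * (S⁻¹ ^ 2).trace := by
  rw [trace_inv_sq_eq_sum hS, Finset.mul_sum]
  refine Finset.sum_congr rfl fun l _ => ?_
  have : (m + 1 : ℝ) ≠ 0 := by positivity
  rw [errorWeight, div_mul_eq_div_div]
  field_simp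

lemma integral_mse_eq (hS : S.PosDef) (θ₀ : EuclideanSpace ℝ (Fin (m + 1))) (σ₀ : ℝ)
    (hm : m + 2 < N) :
    Integrable (mse θ₀) (dataLaw N S θ₀ σ₀) ∧
      ∫ D, mse θ₀ D ∂(dataLaw N S θ₀ σ₀) = σ₀ ^ 2 / ((N : ℝ) - m - 2) * S⁻¹.trace := by
  have hNm : ((N - m : ℕ) : ℝ) = N - m := Nat.cast_sub (by omega)
  have hN : (m : ℝ) + 2 < N := by exact_mod_cast hm
  -- With `d = m + 1`, the condition `N > d + 1` is exactly the finiteness threshold for the mean of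
  -- `ω⁻¹`.
  have hν2 : (1 : ℝ) < ((N - m : ℕ) : ℝ) / 2 := by rw [hNm]; linarith
  have hν0 : (0 : ℝ) < ((N - m : ℕ) : ℝ) / 2 := by linarith
  have := isProbabilityMeasure_gammaMeasure hν0 hν0
  have h := identDistrib_mse hS θ₀ σ₀ (by omega : m < N)
  refine ⟨h.integrable_iff.2 ?_, ?_⟩
  · exact (integrable_inv_gammaMeasure hν2 hν0).mul_prod
      ((memLp_sum_mul_sq _).integrable (by norm_num))
  · rw [h.integral_eq, integral_prod_mul (fun x : ℝ => x⁻¹)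
      (fun h : Fin (m + 1) → ℝ => ∑ l, errorWeight N hS σ₀ l / (m + 1) * h l ^ 2), integral_inv_gammaMeasure hν2 hν0,
      integral_sum_mul_sq, sum_errorWeight_div, hNm]
    have h1 : (N : ℝ) - m ≠ 0 := by linarith
    have h2 : (N : ℝ) - m - 2 ≠ 0 := by linarith
    have h3 : ((N : ℝ) - m) / 2 - 1 ≠ 0 := by intro h; apply h2; linarith
    field_simp

lemma mseVariance_eq_aux (hS : S.PosDef) (θ₀ : EuclideanSpace ℝ (Fin (m + 1))) (σ₀ : ℝ)
    (hm : m + 4 < N) :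
    MemLp (mse θ₀) 2 (dataLaw N S θ₀ σ₀) ∧
      mseVariance N S θ₀ σ₀ = σ₀ ^ 4 / (((N : ℝ) - m - 2) * (N - m - 4)) *
        (S⁻¹.trace ^ 2 + 2 * (S⁻¹ ^ 2).trace) - (σ₀ ^ 2 / ((N : ℝ) - m - 2) * S⁻¹.trace) ^ 2 := by
  have hNm : ((N - m : ℕ) : ℝ) = N - m := Nat.cast_sub (by omega)
  have hN : (m : ℝ) + 4 < N := by exact_mod_cast hm
  have hν2 : (2 : ℝ) < ((N - m : ℕ) : ℝ) / 2 := by rw [hNm]; linarith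
  have hν0 : (0 : ℝ) < ((N - m : ℕ) : ℝ) / 2 := by linarith
  have := isProbabilityMeasure_gammaMeasure hν0 hν0
  have h := identDistrib_mse hS θ₀ σ₀ (by omega : m < N)
  have hL : MemLp (mse θ₀) 2 (dataLaw N S θ₀ σ₀) := by
    rw [h.memLp_iff, memLp_two_iff_integrable_sq (Measurable.aestronglyMeasurable (by fun_prop))]
    simp_rw [mul_pow]
    exact (integrable_inv_sq_gammaMeasure hν2 hν0).mul_prod (memLp_sum_mul_sq _).integrable_sq
  refine ⟨hL, ?_⟩
  rw [mseVariance, variance_eq_sub hL, (integral_mse_eq hS θ₀ σ₀ (by omega : m + 2 < N)).2]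
  congr 1
  have hsq := (h.comp (measurable_id.pow_const 2)).integral_eq
  simp only [Function.comp_def, id] at hsq
  simp only [Pi.pow_apply]
  rw [hsq]
  simp_rw [mul_pow _ (Finset.sum _ _)]
  rw [integral_prod_mul (fun x : ℝ => x⁻¹ ^ 2)
    (fun h : Fin (m + 1) → ℝ => (∑ l, errorWeight N hS σ₀ l / (m + 1) * h l ^ 2) ^ 2),
    integral_inv_sq_gammaMeasure hν2 hν0,
    integral_sum_mul_sq_sq, sum_errorWeight_div, sum_errorWeight_div_sq, hNm]
  have h1 : (N : ℝ) - m ≠ 0 := by linarith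
  have h2 : (N : ℝ) - m - 2 ≠ 0 := by linarith
  have h3 : ((N : ℝ) - m) / 2 - 1 ≠ 0 := by intro h; apply h2; linarith
  have h4 : (N : ℝ) - m - 4 ≠ 0 := by linarith
  have h5 : ((N : ℝ) - m) / 2 - 2 ≠ 0 := by intro h; apply h4; linarith
  rw [show ((N : ℝ) - m) / 2 - 1 = (N - m - 2) / 2 by ring,
    show ((N : ℝ) - m) / 2 - 2 = (N - m - 4) / 2 by ring]
  field_simp

theorem mean_mse {d : ℕ} {S : Matrix (Fin d) (Fin d) ℝ} (hS : S.PosDef)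
    (θ₀ : EuclideanSpace ℝ (Fin d)) (σ₀ : ℝ) (hd : 0 < d) (hm : d + 1 < N) :
    Integrable (mse θ₀) (dataLaw N S θ₀ σ₀) ∧
      ∫ D, mse θ₀ D ∂(dataLaw N S θ₀ σ₀) =
        ratio N d * σ₀ ^ 2 / (1 - ratio N d - 1 / N) * (S⁻¹.trace / d) := by
  obtain ⟨m, rfl⟩ := Nat.exists_eq_add_one_of_ne_zero hd.ne'
  obtain ⟨h1, h2⟩ := integral_mse_eq hS θ₀ σ₀ hm
  refine ⟨h1, ?_⟩
  have hN : (m : ℝ) + 2 < N := by exact_mod_cast hm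
  have hm0 : (0 : ℝ) ≤ m := m.cast_nonneg
  have hN0 : (N : ℝ) ≠ 0 := by linarith
  have h3 : (N : ℝ) - m - 2 ≠ 0 := by linarith
  have h4 : (m : ℝ) + 1 ≠ 0 := by linarith
  have h5 : 1 - ratio N (m + 1) - 1 / N = (N - m - 2) / N := by
    rw [ratio]; push_cast; field_simp; ring
  rw [h2, h5, ratio]
  push_cast
  field_simp

theorem mseVariance_eq {d : ℕ} {S : Matrix (Fin d) (Fin d) ℝ} (hS : S.PosDef)
    (θ₀ : EuclideanSpace ℝ (Fin d)) (σ₀ : ℝ) (hd : 0 < d) (hm : d + 3 < N) :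
    MemLp (mse θ₀) 2 (dataLaw N S θ₀ σ₀) ∧
      mseVariance N S θ₀ σ₀ =
        ratio N d ^ 2 * σ₀ ^ 4 / ((1 - ratio N d - 1 / N) * (1 - ratio N d - 3 / N)) *
          ((S⁻¹.trace / d) ^ 2 + 2 / (d : ℝ) ^ 2 * (S⁻¹ ^ 2).trace) -
        ratio N d ^ 2 * σ₀ ^ 4 / (1 - ratio N d - 1 / N) ^ 2 * (S⁻¹.trace / d) ^ 2 := by
  obtain ⟨m, rfl⟩ := Nat.exists_eq_add_one_of_ne_zero hd.ne'
  obtain ⟨h1, h2⟩ := mseVariance_eq_aux hS θ₀ σ₀ hm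
  refine ⟨h1, ?_⟩
  have hN : (m : ℝ) + 4 < N := by exact_mod_cast hm
  have hm0 : (0 : ℝ) ≤ m := m.cast_nonneg
  have hN0 : (N : ℝ) ≠ 0 := by linarith
  have h3 : (N : ℝ) - m - 2 ≠ 0 := by linarith
  have h4 : (m : ℝ) + 1 ≠ 0 := by linarith
  have h6 : (N : ℝ) - m - 4 ≠ 0 := by linarith
  have h5 : 1 - ratio N (m + 1) - 1 / N = (N - m - 2) / N := by
    rw [ratio]; push_cast; field_simp; ring
  have h7 : 1 - ratio N (m + 1) - 3 / N = (N - m - 4) / N := by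
    rw [ratio]; push_cast; field_simp; ring
  rw [h2, h5, h7, ratio]
  push_cast
  field_simp

end ExactResults

/-! ### Asymptotics of the variance -/

section Asymptotic

variable {d : ℕ} {S : Matrix (Fin d) (Fin d) ℝ}

lemma trace_inv_nonneg (hS : S.PosDef) : 0 ≤ S⁻¹.trace := by
  rw [trace_inv_eq_sum hS]
  exact Finset.sum_nonneg fun l _ => (inv_pos.2 (hS.eigenvalues_pos l)).le

lemma trace_inv_sq_pos (hS : S.PosDef) (hd : 0 < d) : 0 < (S⁻¹ ^ 2).trace := by
  have : NeZero d := ⟨hd.ne'⟩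
  rw [trace_inv_sq_eq_sum hS]
  exact Finset.sum_pos (fun l _ => pow_pos (inv_pos.2 (hS.eigenvalues_pos l)) 2)
    Finset.univ_nonempty

lemma trace_inv_sq_le (hS : S.PosDef) : (S⁻¹ ^ 2).trace ≤ S⁻¹.trace ^ 2 := by
  rw [trace_inv_sq_eq_sum hS, trace_inv_eq_sum hS]
  exact Finset.sum_sq_le_sq_sum_of_nonneg fun l _ => (inv_pos.2 (hS.eigenvalues_pos l)).le

/-- With `c = 1 - ζ`, `k = 1/N`, `a = c - k` and `b = c - 3k`, the two coefficients come from
`1/(ab) - 1/a² = 2k/(a²b)` and `2/(ab) - 2/c² = 2k(4c - 3k)/(abc²)`. Each contains the factor `1/N`.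
-/
lemma mseVariance_sub_asympVariance {N : ℕ} (hS : S.PosDef) (θ₀ : EuclideanSpace ℝ (Fin d))
    (σ₀ : ℝ) (hd : 0 < d) (hN : d + 3 < N) :
    mseVariance N S θ₀ σ₀ - asympVariance N S σ₀ =
      σ₀ ^ 4 * (2 / ((1 - ratio N d - 1 / N) ^ 2 * (1 - ratio N d - 3 / N))) *
          ((ratio N d * (S⁻¹.trace / d)) ^ 2 / N) +
        σ₀ ^ 4 * (2 * (4 * (1 - ratio N d) - 3 / N) / ((1 - ratio N d - 1 / N) *
          (1 - ratio N d - 3 / N) * (1 - ratio N d) ^ 2)) *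
            (ratio N d ^ 2 * ((S⁻¹ ^ 2).trace / d ^ 2) / N) := by
  have hN' : (d : ℝ) + 3 < N := by exact_mod_cast hN
  have hd' : (0 : ℝ) < d := by exact_mod_cast hd
  have hN0 : (0 : ℝ) < N := by linarith
  rw [(mseVariance_eq hS θ₀ σ₀ hd hN).2, asympVariance]
  have h1 : 1 - ratio N d - 1 / N ≠ 0 := by
    rw [ratio, show 1 - (d : ℝ) / N - 1 / N = (N - d - 1) / N by field_simp]
    exact (div_pos (by linarith) hN0).ne'
  have h3 : 1 - ratio N d - 3 / N ≠ 0 := by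
    rw [ratio, show 1 - (d : ℝ) / N - 3 / N = (N - d - 3) / N by field_simp]
    exact (div_pos (by linarith) hN0).ne'
  have h0 : 1 - ratio N d ≠ 0 := by
    rw [ratio, show 1 - (d : ℝ) / N = (N - d) / N by field_simp]
    exact (div_pos (by linarith) hN0).ne'
  rw [div_eq_mul_one_div (3 : ℝ)] at h3 ⊢
  rw [div_eq_mul_one_div (_ ^ 2) (N : ℝ), div_eq_mul_one_div (_ * _) (N : ℝ)]
  generalize ratio N d = r at *
  generalize (1 : ℝ) / N = k at *
  generalize S⁻¹.trace = T
  generalize (S⁻¹ ^ 2).trace = Q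
  obtain ⟨c, hc⟩ : ∃ c, c = 1 - r := ⟨_, rfl⟩
  obtain ⟨a, ha⟩ : ∃ a, a = c - k := ⟨_, rfl⟩
  obtain ⟨b, hb⟩ : ∃ b, b = c - 3 * k := ⟨_, rfl⟩
  simp only [← hc, ← ha, ← hb] at h0 h1 h3 ⊢
  field_simp
  rw [ha, hb]
  ring

lemma asympVariance_pos {N : ℕ} (hS : S.PosDef) {σ₀ : ℝ} (hd : 0 < d) (hσ : 0 < σ₀)
    (hN : d < N) : 0 < asympVariance N S σ₀ := by
  have hd' : (0 : ℝ) < d := by exact_mod_cast hd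
  have hN' : (d : ℝ) < N := by exact_mod_cast hN
  have hN0 : (0 : ℝ) < N := by linarith
  have h0 : 0 < 1 - ratio N d := by
    rw [ratio, show 1 - (d : ℝ) / N = (N - d) / N by field_simp]
    exact div_pos (by linarith) hN0
  have hr : 0 < ratio N d := div_pos hd' hN0
  have := trace_inv_sq_pos hS hd
  unfold asympVariance
  positivity

lemma mseVariance_sub_asympVariance_div {N : ℕ} (hS : S.PosDef) (θ₀ : EuclideanSpace ℝ (Fin d))
    {σ₀ : ℝ} (hd : 0 < d) (hσ : 0 < σ₀) (hN : d + 3 < N) :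
    (mseVariance N S θ₀ σ₀ - asympVariance N S σ₀) / asympVariance N S σ₀ =
      (1 - ratio N d) ^ 2 / ((1 - ratio N d - 1 / N) ^ 2 * (1 - ratio N d - 3 / N)) *
          (S⁻¹.trace ^ 2 / (N * (S⁻¹ ^ 2).trace)) +
        (4 * (1 - ratio N d) - 3 / N) / ((1 - ratio N d - 1 / N) * (1 - ratio N d - 3 / N)) *
          (1 / N) := by
  have hV := asympVariance_pos hS hd hσ (by omega : d < N)
  have hd' : (0 : ℝ) < d := by exact_mod_cast hd
  have hN' : (d : ℝ) + 3 < N := by exact_mod_cast hN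
  have hN0 : (0 : ℝ) < N := by linarith
  have h0 : 1 - ratio N d ≠ 0 := by
    rw [ratio, show 1 - (d : ℝ) / N = (N - d) / N by field_simp]
    exact (div_pos (by linarith) hN0).ne'
  have hr : ratio N d ≠ 0 := (div_pos hd' hN0).ne'
  have hQ := (trace_inv_sq_pos hS hd).ne'
  have hσ' := hσ.ne'
  rw [div_eq_iff hV.ne', mseVariance_sub_asympVariance hS θ₀ σ₀ hd hN, asympVariance]
  generalize 1 - ratio N d - 1 / N = a
  generalize 1 - ratio N d - 3 / N = b
  generalize 4 * (1 - ratio N d) - 3 / N = e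
  generalize 1 - ratio N d = c at *
  generalize ratio N d = r at *
  -- The identity is polynomial in the inverses of `a` and `b`, so these become free symbols and
  -- need no nonvanishing.
  simp only [div_eq_mul_inv, mul_pow, inv_pow, mul_inv, one_mul]
  generalize (a ^ 2)⁻¹ = a2
  generalize a⁻¹ = a1
  generalize b⁻¹ = b1
  field_simp

theorem variance_asymptotics (N d : ℕ → ℕ) (S : (n : ℕ) → Matrix (Fin (d n)) (Fin (d n)) ℝ)
    (θ₀ : (n : ℕ) → EuclideanSpace ℝ (Fin (d n))) (σ₀ ζ : ℝ) (hS : ∀ n, (S n).PosDef)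
    (hd : ∀ n, 0 < d n) (hσ : 0 < σ₀) (hζ : ζ < 1) (hN : Tendsto N atTop atTop)
    (hr : Tendsto (fun n => ratio (N n) (d n)) atTop (𝓝 ζ)) :
    ((fun n => mseVariance (N n) (S n) (θ₀ n) σ₀ - asympVariance (N n) (S n) σ₀) =O[atTop]
        fun n => (ratio (N n) (d n) * ((S n)⁻¹.trace / d n)) ^ 2 / (N n : ℝ)) ∧
      ((∃ C : ℝ, ∀ n, (S n)⁻¹.trace / d n ≤ C) →
        Tendsto (fun n => mseVariance (N n) (S n) (θ₀ n) σ₀ -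
          asympVariance (N n) (S n) σ₀) atTop (𝓝 0)) ∧
      (((fun n => mseVariance (N n) (S n) (θ₀ n) σ₀) ~[atTop]
          fun n => asympVariance (N n) (S n) σ₀) ↔
        Tendsto (fun n => (S n)⁻¹.trace ^ 2 / ((N n : ℝ) * ((S n)⁻¹ ^ 2).trace))
          atTop (𝓝 0)) := by
  have hNr : Tendsto (fun n => (N n : ℝ)) atTop atTop := tendsto_natCast_atTop_atTop.comp hN
  have hk (c : ℝ) : Tendsto (fun n => c / (N n : ℝ)) atTop (𝓝 0) := hNr.const_div_atTop c
  have hc0 : 1 - ζ ≠ 0 := by linarith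
  have hc : Tendsto (fun n => 1 - ratio (N n) (d n)) atTop (𝓝 (1 - ζ)) := hr.const_sub 1
  have ha : Tendsto (fun n => 1 - ratio (N n) (d n) - 1 / N n) atTop (𝓝 (1 - ζ)) := by
    simpa using hc.sub (hk 1)
  have hb : Tendsto (fun n => 1 - ratio (N n) (d n) - 3 / N n) atTop (𝓝 (1 - ζ)) := by
    simpa using hc.sub (hk 3)
  have he : Tendsto (fun n => 4 * (1 - ratio (N n) (d n)) - 3 / N n) atTop
      (𝓝 (4 * (1 - ζ))) := by
    simpa using (hc.const_mul 4).sub (hk 3)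
  -- The limit `1 - ζ` of `1 - d/N - 3/N` is positive, so the exact variance formula eventually
  -- applies.
  have hlarge : ∀ᶠ n in atTop, d n + 3 < N n := by
    filter_upwards [hb.eventually_const_lt (by linarith : (0 : ℝ) < 1 - ζ),
      hN.eventually_ge_atTop 1] with n h1 h2
    have hN0 : (0 : ℝ) < N n := by exact_mod_cast h2
    rw [ratio, show 1 - (d n : ℝ) / N n - 3 / N n = (N n - d n - 3) / N n by field_simp,
      div_pos_iff_of_pos_right hN0] at h1
    have : (d n : ℝ) + 3 < N n := by linarith
    exact_mod_cast this
  have hO : (fun n => mseVariance (N n) (S n) (θ₀ n) σ₀ - asympVariance (N n) (S n) σ₀) =O[atTop]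
      fun n => (ratio (N n) (d n) * ((S n)⁻¹.trace / d n)) ^ 2 / (N n : ℝ) := by
    -- Positive eigenvalues give `Tr[Σ⁻²] ≤ Tr[Σ⁻¹]²`, so the second error term is dominated by the
    -- first.
    have hq : (fun n => ratio (N n) (d n) ^ 2 * (((S n)⁻¹ ^ 2).trace / (d n : ℝ) ^ 2) /
        (N n : ℝ)) =O[atTop]
        fun n => (ratio (N n) (d n) * ((S n)⁻¹.trace / d n)) ^ 2 / (N n : ℝ) := by
      refine IsBigO.of_norm_le fun n => ?_
      have h1 := trace_inv_sq_le (hS n)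
      have h2 := (trace_inv_sq_pos (hS n) (hd n)).le
      rw [Real.norm_of_nonneg (by positivity), mul_pow, div_pow]
      gcongr
    have hA := ((tendsto_const_nhds (x := (2 : ℝ))).div ((ha.pow 2).mul hb)
      (by positivity)).const_mul (σ₀ ^ 4)
    have hB := ((he.const_mul 2).div ((ha.mul hb).mul (hc.pow 2)) (by positivity)).const_mul
      (σ₀ ^ 4)
    have h := ((hA.isBigO_one ℝ).mul (isBigO_refl (fun n =>
      (ratio (N n) (d n) * ((S n)⁻¹.trace / d n)) ^ 2 / (N n : ℝ)) atTop)).add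
        ((hB.isBigO_one ℝ).mul hq)
    simp only [one_mul] at h
    refine h.congr' ?_ EventuallyEq.rfl
    filter_upwards [hlarge] with n hn
    exact (mseVariance_sub_asympVariance (hS n) (θ₀ n) σ₀ (hd n) hn).symm
  refine ⟨hO, fun ⟨C, hC⟩ => hO.trans_tendsto ?_, ?_⟩
  · have hub : Tendsto (fun n => ratio (N n) (d n) ^ 2 * (C ^ 2 / (N n : ℝ))) atTop (𝓝 0) := by
      simpa using (hr.pow 2).mul (hk (C ^ 2))
    refine squeeze_zero (fun n => by positivity) (fun n => ?_) hub
    have h1 : 0 ≤ (S n)⁻¹.trace / d n := div_nonneg (trace_inv_nonneg (hS n)) (by positivity)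
    have h2 := hC n
    rw [mul_pow, mul_div_assoc]
    gcongr
  · have hne : ∀ᶠ n in atTop, asympVariance (N n) (S n) σ₀ ≠ 0 := by
      filter_upwards [hlarge] with n hn
      exact (asympVariance_pos (hS n) (hd n) hσ (by omega)).ne'
    rw [IsEquivalent, isLittleO_iff_tendsto' (hne.mono fun n hn h => absurd h hn)]
    have hA := (hc.pow 2).div ((ha.pow 2).mul hb) (by positivity)
    have hB := (he.div (ha.mul hb) (by positivity)).mul (hk 1)
    rw [mul_zero] at hB
    -- The relative error is `A · Tr[Σ⁻¹]²/(N Tr[Σ⁻²])` plus a null sequence, and `A` tends to `1/(1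
    -- - ζ)`. This limit being nonzero allows division by `A`, which gives the direction from `V ~
    -- V_∞` to the trace condition.
    have hA0 : (1 - ζ) ^ 2 / ((1 - ζ) ^ 2 * (1 - ζ)) ≠ 0 := by positivity
    have heq := hlarge.mono fun n hn =>
      mseVariance_sub_asympVariance_div (hS n) (θ₀ n) (hd n) hσ hn
    simp only [Pi.sub_apply]
    rw [tendsto_congr' heq]
    constructor
    · intro h
      have h2 := (h.sub hB).div hA hA0
      rw [sub_zero, zero_div] at h2
      refine h2.congr' ?_
      filter_upwards [hA.eventually_ne hA0] with n hn
      simp only [Pi.div_apply] at hn ⊢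
      rw [add_sub_cancel_right, mul_div_assoc, mul_comm, div_mul_cancel₀ _ hn]
    · intro h
      have h2 := (hA.mul h).add hB
      rwa [mul_zero, add_zero] at h2

end Asymptotic

end GaussianRegression

theorem mainTheorem5 :
    -- exact results at finite `(N, d)`
    (∀ (N d : ℕ) (S : Matrix (Fin d) (Fin d) ℝ) (hS : S.PosDef)
        (θ₀ : EuclideanSpace ℝ (Fin d)) (σ₀ : ℝ), 0 < d → 0 < σ₀ →
      -- characteristic function
      (d ≤ N → ∀ α : ℝ,
        IntegrableOn (fun ω : ℝ =>
          (GaussianRegression.gammaDensity ((N : ℝ) + 1 - d) ω : ℂ) *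
            ∏ l : Fin d, (1 - Complex.I * α * 2 * GaussianRegression.ratio N d * σ₀ ^ 2 /
              (ω * (1 - GaussianRegression.ratio N d + 1 / N) * hS.isHermitian.eigenvalues l)) ^
                (-(1 / 2) : ℂ)) (Set.Ioi 0) ∧
        ∫ D, Complex.exp (Complex.I * α *
            ((‖θ₀ - GaussianRegression.mlEstimator D‖ ^ 2 : ℝ) : ℂ))
            ∂(GaussianRegression.dataLaw N S θ₀ σ₀) =
          ∫ ω in Set.Ioi (0 : ℝ),
            (GaussianRegression.gammaDensity ((N : ℝ) + 1 - d) ω : ℂ) *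
              ∏ l : Fin d, (1 - Complex.I * α * 2 * GaussianRegression.ratio N d * σ₀ ^ 2 /
                (ω * (1 - GaussianRegression.ratio N d + 1 / N) *
                  hS.isHermitian.eigenvalues l)) ^ (-(1 / 2) : ℂ)) ∧
      -- mean
      (d + 1 < N →
        Integrable (GaussianRegression.mse θ₀) (GaussianRegression.dataLaw N S θ₀ σ₀) ∧
        ∫ D, GaussianRegression.mse θ₀ D ∂(GaussianRegression.dataLaw N S θ₀ σ₀) =
          GaussianRegression.ratio N d * σ₀ ^ 2 / (1 - GaussianRegression.ratio N d - 1 / N) *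
            (S⁻¹.trace / d)) ∧
      -- variance at finite `(N, d)`
      (d + 3 < N →
        MemLp (GaussianRegression.mse θ₀) 2 (GaussianRegression.dataLaw N S θ₀ σ₀) ∧
        GaussianRegression.mseVariance N S θ₀ σ₀ =
          GaussianRegression.ratio N d ^ 2 * σ₀ ^ 4 /
              ((1 - GaussianRegression.ratio N d - 1 / N) *
                (1 - GaussianRegression.ratio N d - 3 / N)) *
              ((S⁻¹.trace / d) ^ 2 + 2 / (d : ℝ) ^ 2 * (S⁻¹ ^ 2).trace) -
            GaussianRegression.ratio N d ^ 2 * σ₀ ^ 4 /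
              (1 - GaussianRegression.ratio N d - 1 / N) ^ 2 * (S⁻¹.trace / d) ^ 2)) ∧
    -- asymptotics of the variance along any sequence with `N → ∞` and `d / N → ζ < 1`
    (∀ (N d : ℕ → ℕ) (S : (n : ℕ) → Matrix (Fin (d n)) (Fin (d n)) ℝ)
        (θ₀ : (n : ℕ) → EuclideanSpace ℝ (Fin (d n))) (σ₀ ζ : ℝ),
      (∀ n, (S n).PosDef) → (∀ n, 0 < d n) → 0 < σ₀ → ζ < 1 →
      Tendsto N atTop atTop →
      Tendsto (fun n => GaussianRegression.ratio (N n) (d n)) atTop (𝓝 ζ) →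
      ((fun n => GaussianRegression.mseVariance (N n) (S n) (θ₀ n) σ₀ -
          GaussianRegression.asympVariance (N n) (S n) σ₀) =O[atTop]
        fun n => (GaussianRegression.ratio (N n) (d n) * ((S n)⁻¹.trace / d n)) ^ 2 / (N n : ℝ)) ∧
      ((∃ C : ℝ, ∀ n, (S n)⁻¹.trace / d n ≤ C) →
        Tendsto (fun n => GaussianRegression.mseVariance (N n) (S n) (θ₀ n) σ₀ -
          GaussianRegression.asympVariance (N n) (S n) σ₀) atTop (𝓝 0)) ∧
      (((fun n => GaussianRegression.mseVariance (N n) (S n) (θ₀ n) σ₀) ~[atTop]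
          fun n => GaussianRegression.asympVariance (N n) (S n) σ₀) ↔
        Tendsto (fun n => (S n)⁻¹.trace ^ 2 / ((N n : ℝ) * ((S n)⁻¹ ^ 2).trace))
          atTop (𝓝 0))) := by
  refine ⟨fun N d S hS θ₀ σ₀ hd _ => ⟨fun hN α => ?_, GaussianRegression.mean_mse hS θ₀ σ₀ hd,
    GaussianRegression.mseVariance_eq hS θ₀ σ₀ hd⟩,
    GaussianRegression.variance_asymptotics⟩
  obtain ⟨m, rfl⟩ := Nat.exists_eq_add_one_of_ne_zero hd.ne'
  -- With `d = m + 1`, the hypothesis `d ≤ N` is by definition `m < N`.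
  exact GaussianRegression.characteristicFunction_norm_sq_error hS θ₀ σ₀ hN α
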